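/- Let $\mathrm{INF}$ be intuitionistic NF: the theory in first-order intuitionistic logic with equality, with the single binary relation symbol $\in$, whose axioms are extensionality and stratified comprehension ($\{x:\varphi(x)\}$ exists for every stratified formula $\varphi$, where $\varphi$ is stratified if each of its variables can be given one non-negative integer index so that $y$ has an index one greater than $x$ in every subformula $x\in y$, and $x$ and $y$ have the same index in every subformula $x=y$). In $\mathrm{INF}$, put $\Lambda=\emptyset$, $\mathsf{zero}=\{\Lambda\}$ and $\kappa^+=\{x:\exists z,a\,(z\in\kappa\wedge a\notin z\wedge x=z\cup\{a\})\}$, and let $\mathbb F$, the set of finite cardinals, be the intersection of all $w$ such that $\mathsf{zero}\in w$, and such that $\mu^+\in w$ whenever $\mu\in w$ and $\mu^+$ is inhabited (has a member). Write $x\sim y$ if there is a one-to-one function from $x$ onto $y$ (functions being sets of ordered pairs $\langle u,v\rangle=\{\{u\},\{u,v\}\}$), and put $$USC(a)=\{\{z\}:z\in a\},\qquad SSC(a)=\{u: u\subseteq a\wedge a=u\cup(a-u)\},$$ $$2^m=\{u:\exists a\,(USC(a)\in m\wedge u\sim SSC(a))\},$$ $$\kappa\le\mu:\iff\exists a,b\,(a\in\kappa\wedge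 b\in\mu\wedge a\subseteq b\wedge b=a\cup(b-a)),\qquad \kappa<\mu:\iff\kappa\le\mu\wedge\kappa\ne\mu.$$ Lemma. The following are theorems of $\mathrm{INF}$. (1) For all $n,m\in\mathbb F$: if $2^n=2^m$ and $2^n$ is inhabited, then $n=m$. (2) For all $m,n\in\mathbb F$: if $m<n$ and $2^n$ is inhabited, then $2^m$ is inhabited and $2^m<2^n$. -/

import Mathlib

namespace INF

/-! ### The language of set theory

Formulas of first-order logic with equality over the single binary relation symbol `∈`, with all
the intuitionistic connectives primitive.  Variables are de Bruijn indices: inside a quantifier the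
bound variable is `0`, and the variable called `x` outside of the quantifier is called `x + 1`. -/

inductive Fml : Type
  | bot : Fml
  | eq : ℕ → ℕ → Fml
  | mem : ℕ → ℕ → Fml
  | and : Fml → Fml → Fml
  | or : Fml → Fml → Fml
  | imp : Fml → Fml → Fml
  | all : Fml → Fml
  | ex : Fml → Fml

infix:60 "≐" => Fml.eq
infix:60 "∊" => Fml.mem
infixr:45 "⋏" => Fml.and
infixr:44 "⋎" => Fml.or
infixr:43 "⇒" => Fml.imp

namespace Fml

def neg (φ : Fml) : Fml := φ ⇒ bot

def iff (φ ψ : Fml) : Fml := (φ ⇒ ψ) ⋏ (ψ ⇒ φ)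

end Fml

infix:42 "⇔" => Fml.iff

/-- A map of variables, pushed below a quantifier. -/
def lift (f : ℕ → ℕ) : ℕ → ℕ
  | 0 => 0
  | i + 1 => f i + 1

namespace Fml

/-- Simultaneous (capture avoiding) replacement of the free variables; the language has no terms
other than variables, so this is substitution. -/
def rename : (ℕ → ℕ) → Fml → Fml
  | _, bot => bot
  | f, eq i j => eq (f i) (f j)
  | f, mem i j => mem (f i) (f j)
  | f, and φ ψ => and (φ.rename f) (ψ.rename f)
  | f, or φ ψ => or (φ.rename f) (ψ.rename f)
  | f, imp φ ψ => imp (φ.rename f) (ψ.rename f)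
  | f, all φ => all (φ.rename (lift f))
  | f, ex φ => ex (φ.rename (lift f))

/-- The same formula, one quantifier deeper. -/
def shift (φ : Fml) : Fml := φ.rename Nat.succ

/-- Instantiation of the variable `0` of `φ` (bound by a quantifier just removed) by `t`. -/
def inst (φ : Fml) (t : ℕ) : Fml :=
  φ.rename fun i => match i with
    | 0 => t
    | k + 1 => k

/-- `φ` is stratified by types of variables, the free variables having the types `τ`: one type per
variable (free or bound), equal types on both sides of `=`, and a type one larger on the right-hand
side of `∈`. -/
def StratifiedBy : (ℕ → ℕ) → Fml → Prop
  | _, bot => True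
  | τ, eq i j => τ i = τ j
  | τ, mem i j => τ j = τ i + 1
  | τ, and φ ψ => φ.StratifiedBy τ ∧ ψ.StratifiedBy τ
  | τ, or φ ψ => φ.StratifiedBy τ ∧ ψ.StratifiedBy τ
  | τ, imp φ ψ => φ.StratifiedBy τ ∧ ψ.StratifiedBy τ
  | τ, all φ => ∃ k : ℕ, φ.StratifiedBy fun i => match i with
      | 0 => k
      | j + 1 => τ j
  | τ, ex φ => ∃ k : ℕ, φ.StratifiedBy fun i => match i with
      | 0 => k
      | j + 1 => τ j

def Stratified (φ : Fml) : Prop := ∃ τ : ℕ → ℕ, φ.StratifiedBy τ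

end Fml

open Fml

/-! ### Intuitionistic Quine set theory

The two axioms: extensionality and stratified comprehension.  Free variables in an instance of
comprehension are parameters, to be read as universally quantified. -/

inductive Postulate : Fml → Prop
  /-- `∀ x y, (∀ z, z ∈ x ↔ z ∈ y) → x = y` -/
  | ext : Postulate (all (all (all (0 ∊ 2 ⇔ 0 ∊ 1) ⇒ 1 ≐ 0)))
  /-- `∃ y, ∀ x, x ∈ y ↔ φ x`, where `x` is the variable `0` of `φ` and `y` is not in `φ` -/
  | comp (φ : Fml) : φ.Stratified →
      Postulate (ex (all (0 ∊ 1 ⇔ φ.rename (lift Nat.succ))))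

/-- Derivability from the postulates in intuitionistic natural deduction with equality: `Deriv Γ φ`
means that `φ` is derivable from the hypotheses `Γ`. -/
inductive Deriv : List Fml → Fml → Prop
  | postulate {Γ : List Fml} {φ : Fml} : Postulate φ → Deriv Γ φ
  | hyp {Γ : List Fml} {φ : Fml} : φ ∈ Γ → Deriv Γ φ
  | botE {Γ : List Fml} {φ : Fml} : Deriv Γ bot → Deriv Γ φ
  | andI {Γ : List Fml} {φ ψ : Fml} : Deriv Γ φ → Deriv Γ ψ → Deriv Γ (φ ⋏ ψ)
  | andE₁ {Γ : List Fml} {φ ψ : Fml} : Deriv Γ (φ ⋏ ψ) → Deriv Γ φ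
  | andE₂ {Γ : List Fml} {φ ψ : Fml} : Deriv Γ (φ ⋏ ψ) → Deriv Γ ψ
  | orI₁ {Γ : List Fml} {φ ψ : Fml} : Deriv Γ φ → Deriv Γ (φ ⋎ ψ)
  | orI₂ {Γ : List Fml} {φ ψ : Fml} : Deriv Γ ψ → Deriv Γ (φ ⋎ ψ)
  | orE {Γ : List Fml} {φ ψ χ : Fml} :
      Deriv Γ (φ ⋎ ψ) → Deriv (φ :: Γ) χ → Deriv (ψ :: Γ) χ → Deriv Γ χ
  | impI {Γ : List Fml} {φ ψ : Fml} : Deriv (φ :: Γ) ψ → Deriv Γ (φ ⇒ ψ)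
  | impE {Γ : List Fml} {φ ψ : Fml} : Deriv Γ (φ ⇒ ψ) → Deriv Γ φ → Deriv Γ ψ
  | allI {Γ : List Fml} {φ : Fml} : Deriv (Γ.map shift) φ → Deriv Γ (all φ)
  | allE {Γ : List Fml} {φ : Fml} (t : ℕ) : Deriv Γ (all φ) → Deriv Γ (φ.inst t)
  | exI {Γ : List Fml} {φ : Fml} (t : ℕ) : Deriv Γ (φ.inst t) → Deriv Γ (ex φ)
  | exE {Γ : List Fml} {φ ψ : Fml} :
      Deriv Γ (ex φ) → Deriv (φ :: Γ.map shift) ψ.shift → Deriv Γ ψ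
  | eqRefl {Γ : List Fml} (i : ℕ) : Deriv Γ (i ≐ i)
  | eqSubst {Γ : List Fml} {i j : ℕ} (φ : Fml) :
      Deriv Γ (i ≐ j) → Deriv Γ (φ.inst i) → Deriv Γ (φ.inst j)

/-- `φ` is a theorem of intuitionistic NF. -/
def Provable (φ : Fml) : Prop := Deriv [] φ

/-! ### Sets and functions

A defined set-valued operation `t` is expressed by the formula `y = t(x)`, that is, by
`∀ u, u ∈ y ↔ u ∈ t(x)`. -/

/-- `x ⊆ y` -/
def subset (x y : ℕ) : Fml := all (0 ∊ x + 1 ⇒ 0 ∊ y + 1)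

/-- `x = Λ` -/
def isEmpty (x : ℕ) : Fml := all (neg (0 ∊ x + 1))

/-- `x` has a member -/
def inhabited (x : ℕ) : Fml := ex (0 ∊ x + 1)

/-- `s = {x}` -/
def isSingleton (s x : ℕ) : Fml := all (0 ∊ s + 1 ⇔ 0 ≐ x + 1)

/-- `p = {x, y}` -/
def isPair (p x y : ℕ) : Fml := all (0 ∊ p + 1 ⇔ (0 ≐ x + 1 ⋎ 0 ≐ y + 1))

/-- `p = ⟨x, y⟩ = {{x}, {x, y}}` -/
def isOrderedPair (p x y : ℕ) : Fml :=
  all (0 ∊ p + 1 ⇔ (isSingleton 0 (x + 1) ⋎ isPair 0 (x + 1) (y + 1)))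

/-- `y = x ∪ {a}` -/
def isAdjoin (y x a : ℕ) : Fml := all (0 ∊ y + 1 ⇔ (0 ∊ x + 1 ⋎ 0 ≐ a + 1))

/-- `b = a ∪ (b - a)` -/
def splits (a b : ℕ) : Fml :=
  all (0 ∊ b + 1 ⇔ (0 ∊ a + 1 ⋎ (0 ∊ b + 1 ⋏ neg (0 ∊ a + 1))))

/-- `⟨x, y⟩ ∈ f` -/
def pairMem (x y f : ℕ) : Fml := ex (isOrderedPair 0 (x + 1) (y + 1) ⋏ 0 ∊ f + 1)

/-- `f` is a function: `∀ x y z, ⟨x, y⟩ ∈ f ∧ ⟨x, z⟩ ∈ f → y = z` -/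
def isFunction (f : ℕ) : Fml :=
  all (all (all ((pairMem 2 1 (f + 3) ⋏ pairMem 2 0 (f + 3)) ⇒ 1 ≐ 0)))

/-- `f : X → Y`: for every `x ∈ X` there is a unique `y ∈ Y` with `⟨x, y⟩ ∈ f` -/
def mapsTo (f X Y : ℕ) : Fml :=
  all (0 ∊ X + 1 ⇒
    ex ((0 ∊ Y + 2 ⋏ pairMem 1 0 (f + 2)) ⋏
      all ((0 ∊ Y + 3 ⋏ pairMem 2 0 (f + 3)) ⇒ 0 ≐ 1)))

/-- The function `f : X → Y` is one-to-one: `∀ x y, y ∈ Y ∧ ⟨x, y⟩ ∈ f → x ∈ X`, and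
`f(x) = f(z) → x = z` for all `x, z ∈ X`; the common value is the variable `0` below. -/
def isOneToOne (f X Y : ℕ) : Fml :=
  all (all ((0 ∊ Y + 2 ⋏ pairMem 1 0 (f + 2)) ⇒ 1 ∊ X + 2)) ⋏
  all (all (all ((2 ∊ X + 3 ⋏ 1 ∊ X + 3 ⋏ pairMem 2 0 (f + 3) ⋏ pairMem 1 0 (f + 3)) ⇒ 2 ≐ 1)))

/-- `f : X → Y` is onto: `∀ y ∈ Y, ∃ x ∈ X, ⟨x, y⟩ ∈ f` -/
def isOnto (f X Y : ℕ) : Fml := all (0 ∊ Y + 1 ⇒ ex (0 ∊ X + 2 ⋏ pairMem 0 1 (f + 2)))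

/-- `x ∼ y`: there is a one-to-one function from `x` onto `y` -/
def similar (x y : ℕ) : Fml :=
  ex (isFunction 0 ⋏ mapsTo 0 (x + 1) (y + 1) ⋏ isOneToOne 0 (x + 1) (y + 1) ⋏
    isOnto 0 (x + 1) (y + 1))

/-- `w = USC(a) = { {z} : z ∈ a }` -/
def isUSC (w a : ℕ) : Fml := all (0 ∊ w + 1 ⇔ ex (0 ∊ a + 2 ⋏ isSingleton 1 0))

/-- `w = SSC(a) = { u : u ⊆ a ∧ a = u ∪ (a - u) }` -/
def isSSC (w a : ℕ) : Fml := all (0 ∊ w + 1 ⇔ (subset 0 (a + 1) ⋏ splits 0 (a + 1)))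

/-! ### Finite cardinals, their order, and exponentiation -/

/-- `z = zero = {Λ}` -/
def isZero (z : ℕ) : Fml := all (0 ∊ z + 1 ⇔ isEmpty 0)

/-- `s = κ⁺ = { x : ∃ z a, z ∈ κ ∧ a ∉ z ∧ x = z ∪ {a} }` -/
def isSucc (s κ : ℕ) : Fml :=
  all (0 ∊ s + 1 ⇔ ex (ex (1 ∊ κ + 3 ⋏ neg (0 ∊ 1) ⋏ isAdjoin 2 1 0)))

/-- `κ ∈ 𝔽`: `κ` belongs to every `w` such that `zero ∈ w`, and such that `μ⁺ ∈ w` whenever `μ ∈ w`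
and `μ⁺` is inhabited (below, `μ` is the variable `1` and `μ⁺` is the variable `0`) -/
def isFiniteCardinal (κ : ℕ) : Fml :=
  all ((ex (isZero 0 ⋏ 0 ∊ 1) ⋏
      all (all (isSucc 0 1 ⇒ (1 ∊ 2 ⋏ inhabited 0) ⇒ 0 ∊ 2))) ⇒
    κ + 1 ∊ 0)

/-- `κ ≤ μ`: `∃ a b, a ∈ κ ∧ b ∈ μ ∧ a ⊆ b ∧ b = a ∪ (b - a)` -/
def le (κ μ : ℕ) : Fml :=
  ex (ex (1 ∊ κ + 2 ⋏ 0 ∊ μ + 2 ⋏ subset 1 0 ⋏ splits 1 0))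

/-- `κ < μ`: `κ ≤ μ ∧ κ ≠ μ` -/
def lt (κ μ : ℕ) : Fml := le κ μ ⋏ neg (κ ≐ μ)

/-- `e = 2^m = { u : ∃ a, USC(a) ∈ m ∧ u ∼ SSC(a) }` -/
def isTwoPow (e m : ℕ) : Fml :=
  all (0 ∊ e + 1 ⇔
    ex (ex (isUSC 0 1 ⋏ 0 ∊ m + 3) ⋏ ex (isSSC 0 1 ⋏ similar 2 0)))

/-- `∀ n m ∈ 𝔽`, if `2^n = 2^m` and `2^n` is inhabited then `n = m`.  The variables bound by the four
outer quantifiers are, from the outside, `n`, `m`, `2^n` and `2^m`. -/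
def twoPowInjective : Fml :=
  all (all ((isFiniteCardinal 1 ⋏ isFiniteCardinal 0) ⇒
    ex (ex (isTwoPow 1 3 ⋏ isTwoPow 0 2 ⋏
      ((1 ≐ 0 ⋏ inhabited 1) ⇒ 3 ≐ 2)))))

/-- `∀ m n ∈ 𝔽`, if `m < n` and `2^n` is inhabited then `2^m` is inhabited and `2^m < 2^n`.  The
variables bound by the four outer quantifiers are, from the outside, `m`, `n`, `2^m` and `2^n`. -/
def twoPowStrictMono : Fml :=
  all (all ((isFiniteCardinal 1 ⋏ isFiniteCardinal 0) ⇒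
    ex (ex (isTwoPow 1 3 ⋏ isTwoPow 0 2 ⋏
      ((lt 3 2 ⋏ inhabited 0) ⇒ (inhabited 1 ⋏ lt 1 0))))))

end INF

namespace INF

open Fml

/-! ### Renaming of variables in derivations -/

/-! Derivations are not written out as trees. Truth values are certain sets of worlds (lists of
hypotheses), and a formula holds at a world exactly if it is derivable there (`Fml.eval_holds`). The
intuitionistic rules thus become lemmas on `Forces`, and an ordinary proof about truth values yields
a derivation.

Call `u` a part of `a` if `u ⊆ a` and membership in `u` is decidable on `a`. Induction over finite
cardinals (`induction`) shows that finite cardinals with a common member are equal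
(`finCard_unique`), that a subset of a finite set with the same cardinal is the whole set
(`incl_of_incl`), and that of two finite sets one has a part in the cardinal of the other
(`part_total`). As `SSC(d ∪ {c})` is the disjoint union of `SSC(d)` and its copy `{u ∪ {c}}`, the
finite cardinal of `SSC(d)` depends only on that of `USC(d)` (`exists_powBound`).

(1) A member of `2^n = 2^m` is similar to `SSC(a)` and to `SSC(b)`, with `USC(a) ∈ n` and `USC(b) ∈
m`, so these lie in one finite cardinal (`mem_of_sim`). Say a part of `USC(a)` lies in `m`; it is
`USC(d)` for a part `d` of `a`. Now `SSC(d) ⊆ SSC(a)` have the same finite cardinal, hence are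
equal; so `a ∈ SSC(d)`, `d = a` and `n = m` (`eq_of_part`).

(2) If `m < n` and `USC(c) ∈ n`, then `USC(c)` has a part `USC(d)` in `m`. Inclusion in `d` is
decidable for parts of `c` (`part_incl_decidable`), so `SSC(d)` is a part of `SSC(c)`; strictness
follows from (1). -/

theorem lift_comp (f g : ℕ → ℕ) : (fun i => lift g (lift f i)) = lift (fun i => g (f i)) := by
  funext i; cases i <;> rfl

theorem lift_id : lift (fun i => i) = fun i => i := by
  funext i; cases i <;> rfl

theorem lift_injective {f : ℕ → ℕ} (hf : Function.Injective f) : Function.Injective (lift f) := by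
  intro i j h
  cases i <;> cases j <;> simp_all [lift, hf.eq_iff]

/-- The environment `σ` extended by the value `t` of the variable `0`. -/
def push (t : ℕ) (σ : ℕ → ℕ) : ℕ → ℕ
  | 0 => t
  | i + 1 => σ i

namespace Fml

theorem rename_rename (φ : Fml) (f g : ℕ → ℕ) :
    (φ.rename f).rename g = φ.rename fun i => g (f i) := by
  induction φ generalizing f g <;> simp_all [rename, lift_comp]

theorem rename_id (φ : Fml) : φ.rename (fun i => i) = φ := by
  induction φ <;> simp_all [rename, lift_id]

/-- An upper bound for the free variables. -/
def bound : Fml → ℕ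
  | bot => 0
  | eq i j => max i j + 1
  | mem i j => max i j + 1
  | and φ ψ => max φ.bound ψ.bound
  | or φ ψ => max φ.bound ψ.bound
  | imp φ ψ => max φ.bound ψ.bound
  | all φ => φ.bound
  | ex φ => φ.bound

theorem lift_congr {n : ℕ} {f g : ℕ → ℕ} (h : ∀ i < n, f i = g i) :
    ∀ i < n, lift f i = lift g i := by
  rintro (_ | i) hi
  · rfl
  · simp [lift, h i (by omega)]

theorem rename_congr {φ : Fml} {f g : ℕ → ℕ} (h : ∀ i < φ.bound, f i = g i) :
    φ.rename f = φ.rename g := by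
  induction φ generalizing f g with
  | bot => rfl
  | eq i j | mem i j => simp [rename, h i (by simp [bound]), h j (by simp [bound])]
  | and φ ψ ih₁ ih₂ | or φ ψ ih₁ ih₂ | imp φ ψ ih₁ ih₂ =>
    simp only [rename]
    rw [ih₁ fun i hi => h i (lt_max_of_lt_left hi), ih₂ fun i hi => h i (lt_max_of_lt_right hi)]
  | all φ ih | ex φ ih =>
    simp only [rename]
    rw [ih (lift_congr h)]

theorem inst_eq (φ : Fml) (t : ℕ) : φ.inst t = φ.rename (push t fun i => i) := by
  unfold inst
  congr 1

theorem rename_inst (φ : Fml) (f : ℕ → ℕ) (t : ℕ) :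
    (φ.inst t).rename f = (φ.rename (lift f)).inst (f t) := by
  rw [inst_eq, inst_eq, rename_rename, rename_rename]
  congr 1
  funext i
  cases i <;> rfl

theorem inst_rename_lift (φ : Fml) (σ : ℕ → ℕ) (t : ℕ) :
    (φ.rename (lift σ)).inst t = φ.rename (push t σ) := by
  rw [inst_eq, rename_rename]
  congr 1
  funext i
  cases i <;> rfl

theorem rename_shift (φ : Fml) (f : ℕ → ℕ) : (φ.rename f).shift = φ.shift.rename (lift f) := by
  unfold shift
  rw [rename_rename, rename_rename]
  rfl

theorem stratifiedBy_rename (φ : Fml) (f τ : ℕ → ℕ) :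
    (φ.rename f).StratifiedBy τ ↔ φ.StratifiedBy fun i => τ (f i) := by
  induction φ generalizing f τ with
  | bot | eq | mem => rfl
  | and φ ψ ih₁ ih₂ | or φ ψ ih₁ ih₂ | imp φ ψ ih₁ ih₂ =>
    simp only [rename, StratifiedBy, ih₁, ih₂]
  | all φ ih | ex φ ih =>
    simp only [rename, StratifiedBy]
    refine exists_congr fun k => ?_
    refine (ih _ _).trans (iff_of_eq (congrArg (fun τ => StratifiedBy τ φ) ?_))
    funext i
    cases i <;> rfl

theorem Stratified.rename {φ : Fml} (h : φ.Stratified) {f : ℕ → ℕ} (hf : Function.Injective f) :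
    (φ.rename f).Stratified := by
  obtain ⟨τ, hτ⟩ := h
  -- An injective renaming has a left inverse, along which the types are carried over.
  refine ⟨fun j => τ (Function.invFun f j), ?_⟩
  rw [stratifiedBy_rename]
  simpa [Function.leftInverse_invFun hf _] using hτ

/-- The instance of comprehension for `φ`. -/
def compr (φ : Fml) : Fml := ex (all (0 ∊ 1 ⇔ φ.rename (lift Nat.succ)))

theorem rename_compr (φ : Fml) (f : ℕ → ℕ) : φ.compr.rename f = (φ.rename (lift f)).compr := by
  have : (φ.rename (lift Nat.succ)).rename (lift (lift f)) =
      (φ.rename (lift f)).rename (lift Nat.succ) := by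
    rw [rename_rename, rename_rename]
    congr 1
    funext i
    cases i <;> rfl
  simp [compr, iff, Fml.rename, this, lift]

end Fml

/-- Injectivity matters: identifying variables can destroy stratification, as it turns `x ∊ y` into
`x ∊ x`. -/
theorem Postulate.rename {φ : Fml} (h : Postulate φ) {f : ℕ → ℕ} (hf : Function.Injective f) :
    Postulate (φ.rename f) := by
  cases h with
  | ext => exact Postulate.ext
  | comp φ hφ =>
    have := Postulate.comp _ (hφ.rename (lift_injective hf))
    rwa [← compr, ← rename_compr] at this

namespace Deriv

theorem rename {Γ : List Fml} {φ : Fml} (h : Deriv Γ φ) {f : ℕ → ℕ} (hf : Function.Injective f) :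
    Deriv (Γ.map (Fml.rename f)) (φ.rename f) := by
  have key : ∀ (Γ : List Fml) (f : ℕ → ℕ),
      (Γ.map (Fml.rename f)).map shift = (Γ.map shift).map (Fml.rename (lift f)) := by
    intro Γ f
    simp [Function.comp_def, rename_shift]
  induction h generalizing f with
  | postulate h => exact postulate (h.rename hf)
  | hyp h => exact hyp (List.mem_map_of_mem h)
  | botE _ ih => exact botE (ih hf)
  | andI _ _ ih₁ ih₂ => exact andI (ih₁ hf) (ih₂ hf)
  | andE₁ _ ih => exact andE₁ (ih hf)
  | andE₂ _ ih => exact andE₂ (ih hf)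
  | orI₁ _ ih => exact orI₁ (ih hf)
  | orI₂ _ ih => exact orI₂ (ih hf)
  | orE _ _ _ ih₁ ih₂ ih₃ => exact orE (ih₁ hf) (ih₂ hf) (ih₃ hf)
  | impI _ ih => exact impI (ih hf)
  | impE _ _ ih₁ ih₂ => exact impE (ih₁ hf) (ih₂ hf)
  | allI _ ih =>
    refine allI ?_
    rw [key]
    exact ih (lift_injective hf)
  | allE t _ ih =>
    rw [rename_inst]
    exact allE _ (ih hf)
  | exI t _ ih =>
    refine exI (f t) ?_
    rw [← rename_inst]
    exact ih hf
  | exE _ _ ih₁ ih₂ =>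
    refine exE (ih₁ hf) ?_
    rw [key, rename_shift]
    exact ih₂ (lift_injective hf)
  | eqRefl i => exact eqRefl _
  | eqSubst φ _ _ ih₁ ih₂ =>
    rw [rename_inst]
    refine eqSubst _ (ih₁ hf) ?_
    rw [← rename_inst]
    exact ih₂ hf

theorem weaken {Γ Δ : List Fml} {φ : Fml} (h : Deriv Γ φ) (hs : Γ ⊆ Δ) : Deriv Δ φ := by
  induction h generalizing Δ with
  | postulate h => exact postulate h
  | hyp h => exact hyp (hs h)
  | botE _ ih => exact botE (ih hs)
  | andI _ _ ih₁ ih₂ => exact andI (ih₁ hs) (ih₂ hs)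
  | andE₁ _ ih => exact andE₁ (ih hs)
  | andE₂ _ ih => exact andE₂ (ih hs)
  | orI₁ _ ih => exact orI₁ (ih hs)
  | orI₂ _ ih => exact orI₂ (ih hs)
  | orE _ _ _ ih₁ ih₂ ih₃ =>
    exact orE (ih₁ hs) (ih₂ (List.cons_subset_cons _ hs)) (ih₃ (List.cons_subset_cons _ hs))
  | impI _ ih => exact impI (ih (List.cons_subset_cons _ hs))
  | impE _ _ ih₁ ih₂ => exact impE (ih₁ hs) (ih₂ hs)
  | allI _ ih => exact allI (ih (List.map_subset _ hs))
  | allE t _ ih => exact allE t (ih hs)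
  | exI t _ ih => exact exI t (ih hs)
  | exE _ _ ih₁ ih₂ =>
    exact exE (ih₁ hs) (ih₂ (List.cons_subset_cons _ (List.map_subset _ hs)))
  | eqRefl i => exact eqRefl i
  | eqSubst φ _ _ ih₁ ih₂ => exact eqSubst φ (ih₁ hs) (ih₂ hs)

/-- A variable beyond those of `Γ` and `φ` may be generalized. -/
theorem generalize {Γ : List Fml} {φ : Fml} {t : ℕ} (hΓ : ∀ ψ ∈ Γ, ψ.bound ≤ t)
    (hφ : φ.bound ≤ t) (h : Deriv Γ (φ.inst t)) : Deriv (Γ.map shift) φ := by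
  -- `f` turns the fresh `t` into the variable to be bound and shifts all others.
  let f : ℕ → ℕ := fun i => if i = t then 0 else i + 1
  have hf : Function.Injective f := by
    intro i j hij
    simp only [f] at hij
    split_ifs at hij <;> omega
  have := h.rename hf
  rw [inst_eq, rename_rename] at this
  convert this using 1
  · refine List.map_congr_left fun ψ hψ => rename_congr fun i hi => ?_
    have := hΓ ψ hψ
    simp only [f, if_neg (show i ≠ t by omega)]
  · conv_lhs => rw [← rename_id φ]
    refine rename_congr fun i hi => ?_
    cases i with
    | zero => simp [push, f]
    | succ i => simp [push, f, show i ≠ t by omega]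

theorem exists_fresh (Γ : List Fml) : ∃ n, ∀ ψ ∈ Γ, ψ.bound ≤ n := by
  induction Γ with
  | nil => exact ⟨0, by simp⟩
  | cons φ Γ ih =>
    obtain ⟨n, hn⟩ := ih
    refine ⟨max φ.bound n, ?_⟩
    intro ψ hψ
    rcases List.mem_cons.1 hψ with rfl | hψ
    · exact le_max_left _ _
    · exact (hn ψ hψ).trans (le_max_right _ _)

/-- A fresh instance would suffice; asking for all `t` lets a Lean variable play the eigenvariable.
The same holds for `of_ex`. -/
theorem all_of_forall {Γ : List Fml} {φ : Fml} (h : ∀ t, Deriv Γ (φ.inst t)) :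
    Deriv Γ (all φ) := by
  obtain ⟨n, hn⟩ := exists_fresh (φ :: Γ)
  exact allI (generalize (fun ψ hψ => hn ψ (List.mem_cons_of_mem _ hψ)) (hn φ List.mem_cons_self)
    (h n))

theorem of_ex {Γ : List Fml} {φ χ : Fml} (h : Deriv Γ (ex φ))
    (hχ : ∀ t, Deriv (φ.inst t :: Γ) χ) : Deriv Γ χ := by
  obtain ⟨n, hn⟩ := exists_fresh (φ :: χ.shift :: Γ)
  refine exE h ?_
  have h1 : Deriv Γ ((φ ⇒ χ.shift).inst n) := by
    have : (φ ⇒ χ.shift).inst n = (φ.inst n ⇒ χ) := by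
      have : (χ.shift).inst n = χ := by
        rw [inst_eq, shift, rename_rename]
        exact rename_id χ
      conv_rhs => rw [← this]
      rfl
    rw [this]
    exact impI (hχ n)
  have h2 := generalize (φ := φ ⇒ χ.shift) (fun ψ hψ => hn ψ (by simp [hψ]))
    (max_le (hn φ (by simp)) (hn χ.shift (by simp))) h1
  exact impE (h2.weaken (List.subset_cons_self _ _)) (hyp List.mem_cons_self)

/-- A formula derivable from no hypotheses is derivable for all values of its free variables. -/
theorem rename_of_forall {φ : Fml} (h : ∀ Γ, Deriv Γ φ) (σ : ℕ → ℕ) (Γ : List Fml) :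
    Deriv Γ (φ.rename σ) := by
  -- `σ` need not be injective, so `Deriv.rename` does not apply; variables are generalized and
  -- instantiated one at a time.
  have key : ∀ (k : ℕ) (φ : Fml), (∀ Γ, Deriv Γ φ) → ∀ (σ : ℕ → ℕ) (Γ : List Fml),
      Deriv Γ (φ.rename fun i => if i < k then σ i else i - k) := by
    intro k
    induction k with
    | zero =>
      intro φ h σ Γ
      simpa using (rename_id φ).symm ▸ h Γ
    | succ k ih =>
      intro φ h σ Γ
      -- The renaming that follows lowers variables from `k` on by `k`, which brings `σ 0 + k` back
      -- to `σ 0`.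
      have h1 := ih (φ.inst (σ 0 + k)) (fun Γ => allE _ (allI (h _))) (fun i => σ (i + 1)) Γ
      rw [inst_eq, rename_rename] at h1
      convert h1 using 2
      funext i
      cases i with
      | zero => simp [push]
      | succ i => by_cases hi : i < k <;> simp [push, hi]
  have := key φ.bound φ h σ Γ
  rwa [rename_congr (g := σ) fun i hi => if_pos hi] at this

end Deriv

/-! ### Truth values

A Beth model whose worlds are the finite lists of hypotheses and whose individuals are the
variables.  It validates exactly what is derivable, and it allows derivations to be given as
ordinary proofs about its truth values. -/

abbrev World := List Fml

/-- A set of worlds that is closed under adding hypotheses, and local: it contains `p` if every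
formula that follows from it, in some list of hypotheses after `p`, is derivable there. -/
structure Truth where
  holds : World → Prop
  mono : ∀ {p q : World}, p ⊆ q → holds p → holds q
  loc : ∀ {p : World}, (∀ (χ : Fml) (q : World), p ⊆ q →
    (∀ r : World, q ⊆ r → holds r → Deriv r χ) → Deriv q χ) → holds p

/-- `Forces p A`: the truth value `A` holds in the world `p`. -/
structure Forces (p : World) (A : Truth) : Prop where
  holds : A.holds p

infix:20 "⊩" => Forces

/-- `q` is a later world than `p`. -/
class Le (p q : World) : Prop where
  sub : p ⊆ q

instance Le.refl (p : World) : Le p p := ⟨fun _ h => h⟩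

-- The middle world is found among the local instances, so facts pass through nested hypotheses
-- without explicit inclusions.
set_option synthInstance.checkSynthOrder false in
instance Le.trans {p q r : World} [hq : Le q r] [hp : Le p q] : Le p r :=
  ⟨fun _ h => hq.sub (hp.sub h)⟩

/-- What holds in a world holds from it on. -/
theorem Forces.persist {p : World} {A : Truth} (h : p ⊩ A) {q : World} [Le p q] : q ⊩ A :=
  ⟨A.mono Le.sub h.holds⟩

namespace Truth

/-- The least truth value that holds wherever `S` does. -/
def closure (S : World → Prop) : Truth where
  holds p := ∀ (χ : Fml) (q : World), p ⊆ q → (∀ r : World, q ⊆ r → S r → Deriv r χ) → Deriv q χ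
  mono hpq h χ r hr := h χ r (List.Subset.trans hpq hr)
  loc h χ q hq hS := h χ q hq fun r hr hr' => hr' χ r (fun _ h => h) fun s hs =>
    hS s (List.Subset.trans hr hs)

theorem closure_of {S : World → Prop} (hS : ∀ p q : World, p ⊆ q → S p → S q) {p : World}
    (h : S p) : (closure S).holds p := fun _ q hq hχ => hχ q (fun _ h => h) (hS p q hq h)

theorem closure_elim {S : World → Prop} {p : World} {C : Truth} (h : (closure S).holds p)
    (hC : ∀ q : World, p ⊆ q → S q → C.holds q) : C.holds p :=
  C.loc fun χ q hq hr => h χ q hq fun r hqr hS => hr r hqr (hC r (List.Subset.trans hq hqr) hS)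

/-- Derivability of a formula. -/
def atom (φ : Fml) : Truth where
  holds p := Deriv p φ
  mono hpq h := h.weaken hpq
  loc h := h φ _ (fun _ h => h) fun _ _ h => h

/-- Inconsistent worlds force falsity, and a derivable disjunction or existential need have no
derivable disjunct or instance: hence the closures here, in `or` and in `ex`. -/
def bot : Truth := closure fun _ => False

def and (A B : Truth) : Truth where
  holds p := A.holds p ∧ B.holds p
  mono hpq h := ⟨A.mono hpq h.1, B.mono hpq h.2⟩
  loc h := ⟨A.loc fun χ q hq hr => h χ q hq fun r hqr hAB => hr r hqr hAB.1,
    B.loc fun χ q hq hr => h χ q hq fun r hqr hAB => hr r hqr hAB.2⟩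

def or (A B : Truth) : Truth := closure fun p => A.holds p ∨ B.holds p

def imp (A B : Truth) : Truth where
  holds p := ∀ q : World, p ⊆ q → A.holds q → B.holds q
  mono hpq h r hr := h r (List.Subset.trans hpq hr)
  loc h _ hq hA := B.loc fun χ r hr hχ => h χ r (List.Subset.trans hq hr) fun s hs hAB =>
    hχ s hs (hAB s (fun _ h => h) (A.mono (List.Subset.trans hr hs) hA))

def all (P : ℕ → Truth) : Truth where
  holds p := ∀ x, (P x).holds p
  mono hpq h x := (P x).mono hpq (h x)
  loc h x := (P x).loc fun χ q hq hr => h χ q hq fun r hqr hP => hr r hqr (hP x)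

def ex (P : ℕ → Truth) : Truth := closure fun p => ∃ x, (P x).holds p

def neg (A : Truth) : Truth := imp A bot

def iff (A B : Truth) : Truth := and (imp A B) (imp B A)

def eq (x y : ℕ) : Truth := atom (x ≐ y)

def mem (x y : ℕ) : Truth := atom (x ∊ y)

end Truth

infixr:45 "∧ₜ" => Truth.and
infixr:44 "∨ₜ" => Truth.or
infixr:43 "→ₜ" => Truth.imp
infix:42 "↔ₜ" => Truth.iff
infix:60 "=ₜ" => Truth.eq
infix:60 "∈ₜ" => Truth.mem
prefix:70 "¬ₜ" => Truth.neg

/-- The truth value of a formula in an environment. -/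
def Fml.eval : Fml → (ℕ → ℕ) → Truth
  | bot, _ => Truth.bot
  | eq i j, σ => σ i =ₜ σ j
  | mem i j, σ => σ i ∈ₜ σ j
  | and φ ψ, σ => φ.eval σ ∧ₜ ψ.eval σ
  | or φ ψ, σ => φ.eval σ ∨ₜ ψ.eval σ
  | imp φ ψ, σ => φ.eval σ →ₜ ψ.eval σ
  | all φ, σ => Truth.all fun x => φ.eval (push x σ)
  | ex φ, σ => Truth.ex fun x => φ.eval (push x σ)

/-- For falsity, disjunction and existence, one direction tests the closure against the formula
itself, and the other is the elimination rule. -/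
theorem Fml.eval_holds (φ : Fml) (σ : ℕ → ℕ) (p : World) :
    (φ.eval σ).holds p ↔ Deriv p (φ.rename σ) := by
  induction φ generalizing σ p with
  | bot => exact ⟨fun h => h bot p (fun _ h => h) fun _ _ h => h.elim, fun h χ q hq _ =>
      (h.weaken hq).botE⟩
  | eq | mem => exact Iff.rfl
  | and φ ψ ih₁ ih₂ =>
    exact ⟨fun h => .andI ((ih₁ σ p).1 h.1) ((ih₂ σ p).1 h.2), fun h =>
      ⟨(ih₁ σ p).2 h.andE₁, (ih₂ σ p).2 h.andE₂⟩⟩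
  | or φ ψ ih₁ ih₂ =>
    refine ⟨fun h => h _ p (fun _ h => h) fun r _ hr => ?_, fun h χ q hq hχ => ?_⟩
    · exact hr.elim (fun hr => .orI₁ ((ih₁ σ r).1 hr)) fun hr => .orI₂ ((ih₂ σ r).1 hr)
    · refine (h.weaken hq).orE (hχ _ (List.subset_cons_self _ _) (Or.inl ?_))
        (hχ _ (List.subset_cons_self _ _) (Or.inr ?_))
      · exact (ih₁ _ _).2 (.hyp List.mem_cons_self)
      · exact (ih₂ _ _).2 (.hyp List.mem_cons_self)
  | imp φ ψ ih₁ ih₂ =>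
    refine ⟨fun h => .impI ((ih₂ _ _).1 (h _ (List.subset_cons_self _ _)
      ((ih₁ _ _).2 (.hyp List.mem_cons_self)))), fun h q hq hφ => (ih₂ _ _).2 ?_⟩
    exact (h.weaken hq).impE ((ih₁ _ _).1 hφ)
  | all φ ih =>
    refine ⟨fun h => Deriv.all_of_forall fun t => ?_, fun h x => (ih _ _).2 ?_⟩
    · rw [inst_rename_lift]
      exact (ih _ _).1 (h t)
    · rw [← inst_rename_lift]
      exact .allE x h
  | ex φ ih =>
    refine ⟨fun h => h _ p (fun _ h => h) fun r _ hr => ?_, fun h χ q hq hχ => ?_⟩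
    · obtain ⟨x, hx⟩ := hr
      refine .exI x ?_
      rw [inst_rename_lift]
      exact (ih _ _).1 hx
    · refine (h.weaken hq).of_ex fun t => hχ _ (List.subset_cons_self _ _) ⟨t, (ih _ _).2 ?_⟩
      rw [← inst_rename_lift]
      exact .hyp List.mem_cons_self

theorem Fml.provable_of_forces {φ : Fml} (h : ∀ p, p ⊩ φ.eval fun i => i) : Provable φ := by
  have := (φ.eval_holds _ _).1 (h []).holds
  rwa [rename_id] at this

/-! ### Rules of inference -/

namespace Forces

variable {p : World} {A B C : Truth} {P : ℕ → Truth}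

/-- Turns a fact at `p` into one usable at all later worlds, as needed inside hypothetical
reasoning. -/
theorem bind (h : p ⊩ A) (hC : (∀ {r : World} [Le p r], r ⊩ A) → (p ⊩ C)) : p ⊩ C := hC h.persist

theorem botE (h : p ⊩ Truth.bot) : p ⊩ C := ⟨Truth.closure_elim h.holds fun _ _ h => h.elim⟩

theorem andI (hA : p ⊩ A) (hB : p ⊩ B) : p ⊩ A ∧ₜ B := ⟨⟨hA.holds, hB.holds⟩⟩

theorem left (h : p ⊩ A ∧ₜ B) : p ⊩ A := ⟨h.holds.1⟩

theorem right (h : p ⊩ A ∧ₜ B) : p ⊩ B := ⟨h.holds.2⟩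

theorem inl (h : p ⊩ A) : p ⊩ A ∨ₜ B :=
  ⟨Truth.closure_of (fun _ _ hpq h => h.imp (A.mono hpq) (B.mono hpq)) (Or.inl h.holds)⟩

theorem inr (h : p ⊩ B) : p ⊩ A ∨ₜ B :=
  ⟨Truth.closure_of (fun _ _ hpq h => h.imp (A.mono hpq) (B.mono hpq)) (Or.inr h.holds)⟩

theorem cases (h : p ⊩ A ∨ₜ B)
    (hA : ∀ {q : World} [Le p q], (∀ {r : World} [Le q r], r ⊩ A) → (q ⊩ C))
    (hB : ∀ {q : World} [Le p q], (∀ {r : World} [Le q r], r ⊩ B) → (q ⊩ C)) : p ⊩ C :=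
  ⟨Truth.closure_elim h.holds fun _ hq h => (Or.elim h
    (fun h => have : Le _ _ := ⟨hq⟩; hA (Forces.mk h).persist)
    (fun h => have : Le _ _ := ⟨hq⟩; hB (Forces.mk h).persist)).holds⟩

theorem impI (h : ∀ {q : World} [Le p q], (∀ {r : World} [Le q r], r ⊩ A) → (q ⊩ B)) : p ⊩ A →ₜ B :=
  ⟨fun _ hq hA => have : Le _ _ := ⟨hq⟩; (h (Forces.mk hA).persist).holds⟩

theorem mp (h : p ⊩ A →ₜ B) (hA : p ⊩ A) : p ⊩ B := ⟨h.holds p (fun _ h => h) hA.holds⟩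

theorem negI (h : ∀ {q : World} [Le p q], (∀ {r : World} [Le q r], r ⊩ A) → (q ⊩ Truth.bot)) :
    p ⊩ ¬ₜ A := impI h

theorem absurd (h : p ⊩ ¬ₜ A) (hA : p ⊩ A) : p ⊩ C := (mp h hA).botE

theorem iffI (hAB : ∀ {q : World} [Le p q], (∀ {r : World} [Le q r], r ⊩ A) → (q ⊩ B))
    (hBA : ∀ {q : World} [Le p q], (∀ {r : World} [Le q r], r ⊩ B) → (q ⊩ A)) : p ⊩ A ↔ₜ B :=
  andI (impI hAB) (impI hBA)

theorem iffE (h : p ⊩ A ↔ₜ B) (hA : p ⊩ A) : p ⊩ B := (left h).mp hA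

theorem iffE' (h : p ⊩ A ↔ₜ B) (hB : p ⊩ B) : p ⊩ A := (right h).mp hB

theorem allI (h : ∀ x, p ⊩ P x) : p ⊩ Truth.all P := ⟨fun x => (h x).holds⟩

theorem allE (h : p ⊩ Truth.all P) (x : ℕ) : p ⊩ P x := ⟨h.holds x⟩

theorem exI (x : ℕ) (h : p ⊩ P x) : p ⊩ Truth.ex P :=
  ⟨Truth.closure_of (fun _ _ hpq ⟨y, hy⟩ => ⟨y, (P y).mono hpq hy⟩) ⟨x, h.holds⟩⟩

theorem exE (h : p ⊩ Truth.ex P)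
    (hC : ∀ {q : World} [Le p q] (x : ℕ), (∀ {r : World} [Le q r], r ⊩ P x) → (q ⊩ C)) : p ⊩ C :=
  ⟨Truth.closure_elim h.holds fun _ hq ⟨x, h⟩ =>
    (have : Le _ _ := ⟨hq⟩; hC x (Forces.mk h).persist).holds⟩

end Forces

open Forces

/-! ### Equality, extensionality and comprehension as rules -/

theorem eq_refl {p : World} (x : ℕ) : p ⊩ x =ₜ x := ⟨.eqRefl x⟩

theorem eq_subst (φ : Fml) (σ : ℕ → ℕ) {p : World} {x y : ℕ} (h : p ⊩ x =ₜ y)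
    (hx : p ⊩ φ.eval (push x σ)) : p ⊩ φ.eval (push y σ) := by
  have := (eval_holds _ _ _).1 hx.holds
  rw [← inst_rename_lift] at this
  refine ⟨(eval_holds _ _ _).2 ?_⟩
  rw [← inst_rename_lift]
  exact Deriv.eqSubst _ h.holds this

theorem Forces.symm {p : World} {x y : ℕ} (h : p ⊩ x =ₜ y) : p ⊩ y =ₜ x :=
  eq_subst (0 ≐ 1) (push x id) h (eq_refl x)

theorem Forces.trans {p : World} {x y z : ℕ} (h : p ⊩ x =ₜ y) (h' : p ⊩ y =ₜ z) : p ⊩ x =ₜ z :=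
  eq_subst (1 ≐ 0) (push x id) h' h

theorem Forces.memL {p : World} {x y z : ℕ} (h : p ⊩ x =ₜ y) (h' : p ⊩ x ∈ₜ z) : p ⊩ y ∈ₜ z :=
  eq_subst (0 ∊ 1) (push z id) h h'

theorem Forces.memR {p : World} {x y z : ℕ} (h : p ⊩ x =ₜ y) (h' : p ⊩ z ∈ₜ x) : p ⊩ z ∈ₜ y :=
  eq_subst (1 ∊ 0) (push z id) h h'

theorem extensionality {p : World} {x y : ℕ}
    (h : ∀ {q : World} [Le p q] (z : ℕ), (∀ {r : World} [Le q r], r ⊩ z ∈ₜ x) → (q ⊩ z ∈ₜ y))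
    (h' : ∀ {q : World} [Le p q] (z : ℕ), (∀ {r : World} [Le q r], r ⊩ z ∈ₜ y) → (q ⊩ z ∈ₜ x)) :
    p ⊩ x =ₜ y := by
  have ax : p ⊩ (all (all (all (0 ∊ 2 ⇔ 0 ∊ 1) ⇒ 1 ≐ 0))).eval id :=
    ⟨(eval_holds _ _ _).2 (.postulate .ext)⟩
  exact ((ax.allE x).allE y).mp (allI fun z => iffI (h z) (h' z))

theorem comprehension (φ : Fml) (τ σ : ℕ → ℕ) (hφ : φ.StratifiedBy τ) (p : World) :
    p ⊩ Truth.ex fun y => Truth.all fun x => x ∈ₜ y ↔ₜ φ.eval (push x σ) := by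
  have h1 := Deriv.rename_of_forall (fun Γ => .postulate (Γ := Γ) (Postulate.comp φ ⟨τ, hφ⟩)) σ p
  have h2 : p ⊩ φ.compr.eval σ := ⟨(eval_holds _ _ _).2 h1⟩
  refine h2.exE fun y h => exI y (allI fun x => ?_)
  -- A truth value is determined by the worlds where it holds.
  have h3 : ∀ (A : Truth), (A.holds = (φ.eval (push x σ)).holds) → A = φ.eval (push x σ) := by
    rintro ⟨⟩ h
    cases h
    rfl
  have h4 : (φ.rename (lift Nat.succ)).eval (push x (push y σ)) = φ.eval (push x σ) := by
    apply h3
    funext q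
    rw [eq_iff_iff, eval_holds, eval_holds, rename_rename]
    have : (fun i => push x (push y σ) (lift Nat.succ i)) = push x σ := by
      funext i
      cases i <;> rfl
    rw [this]
  rw [← h4]
  exact h.allE x

/-! ### The defined notions as truth values -/

/-- These notions are definitionally the values under `Fml.eval` of the corresponding formulas, so
`rfl` and `change` pass between the two. -/
def Incl (x y : ℕ) : Truth := .all fun z => z ∈ₜ x →ₜ z ∈ₜ y

def Void (x : ℕ) : Truth := .all fun z => ¬ₜ (z ∈ₜ x)

def Inh (x : ℕ) : Truth := .ex fun z => z ∈ₜ x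

def Sing (s x : ℕ) : Truth := .all fun z => z ∈ₜ s ↔ₜ z =ₜ x

def UPair (s x y : ℕ) : Truth := .all fun z => z ∈ₜ s ↔ₜ (z =ₜ x ∨ₜ z =ₜ y)

def OPair (s x y : ℕ) : Truth := .all fun z => z ∈ₜ s ↔ₜ (Sing z x ∨ₜ UPair z x y)

def Adj (y x a : ℕ) : Truth := .all fun z => z ∈ₜ y ↔ₜ (z ∈ₜ x ∨ₜ z =ₜ a)

def Spl (a b : ℕ) : Truth := .all fun z => z ∈ₜ b ↔ₜ (z ∈ₜ a ∨ₜ (z ∈ₜ b ∧ₜ ¬ₜ (z ∈ₜ a)))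

def PairMem (x y f : ℕ) : Truth := .ex fun s => OPair s x y ∧ₜ s ∈ₜ f

def Func (f : ℕ) : Truth :=
  .all fun x => .all fun y => .all fun z => (PairMem x y f ∧ₜ PairMem x z f) →ₜ y =ₜ z

def Maps (f X Y : ℕ) : Truth :=
  .all fun x => x ∈ₜ X →ₜ .ex fun y => (y ∈ₜ Y ∧ₜ PairMem x y f) ∧ₜ
    .all fun z => (z ∈ₜ Y ∧ₜ PairMem x z f) →ₜ z =ₜ y

def OneOne (f X Y : ℕ) : Truth :=
  (.all fun x => .all fun y => (y ∈ₜ Y ∧ₜ PairMem x y f) →ₜ x ∈ₜ X) ∧ₜ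
  .all fun x => .all fun z => .all fun y =>
    (x ∈ₜ X ∧ₜ z ∈ₜ X ∧ₜ PairMem x y f ∧ₜ PairMem z y f) →ₜ x =ₜ z

def Onto (f X Y : ℕ) : Truth :=
  .all fun y => y ∈ₜ Y →ₜ .ex fun x => x ∈ₜ X ∧ₜ PairMem x y f

def Sim (x y : ℕ) : Truth := .ex fun f => Func f ∧ₜ Maps f x y ∧ₜ OneOne f x y ∧ₜ Onto f x y

def Usc (w a : ℕ) : Truth := .all fun s => s ∈ₜ w ↔ₜ .ex fun z => z ∈ₜ a ∧ₜ Sing s z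

/-- Intuitionistically the second conjunct says that membership in `u` is decidable on `a`; see
`part_cases` and `part_intro`. -/
def Part (u a : ℕ) : Truth := Incl u a ∧ₜ Spl u a

def Ssc (w a : ℕ) : Truth := .all fun u => u ∈ₜ w ↔ₜ Part u a

def ZeroCard (z : ℕ) : Truth := .all fun x => x ∈ₜ z ↔ₜ Void x

def SuccCard (s k : ℕ) : Truth :=
  .all fun x => x ∈ₜ s ↔ₜ .ex fun z => .ex fun a => z ∈ₜ k ∧ₜ ¬ₜ (a ∈ₜ z) ∧ₜ Adj x z a

def FinCard (k : ℕ) : Truth :=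
  .all fun w => ((.ex fun z => ZeroCard z ∧ₜ z ∈ₜ w) ∧ₜ
    .all fun m => .all fun s => SuccCard s m →ₜ (m ∈ₜ w ∧ₜ Inh s) →ₜ s ∈ₜ w) →ₜ k ∈ₜ w

def CardLe (k m : ℕ) : Truth :=
  .ex fun a => .ex fun b => a ∈ₜ k ∧ₜ b ∈ₜ m ∧ₜ Part a b

def CardLt (k m : ℕ) : Truth := CardLe k m ∧ₜ ¬ₜ (k =ₜ m)

def TwoPow (e m : ℕ) : Truth :=
  .all fun u => u ∈ₜ e ↔ₜ .ex fun a =>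
    (.ex fun w => Usc w a ∧ₜ w ∈ₜ m) ∧ₜ .ex fun S => Ssc S a ∧ₜ Sim u S

/-! ### Elementary set theory -/

section

variable {p : World} {C : Truth} {a b c d s t u w x y z : ℕ}

theorem Forces.incl (h : p ⊩ Incl x y) (hz : p ⊩ z ∈ₜ x) : p ⊩ z ∈ₜ y := (h.allE z).mp hz

theorem incl_intro (h : ∀ {q : World} [Le p q] (z : ℕ), (∀ {r : World} [Le q r], r ⊩ z ∈ₜ x) →
    (q ⊩ z ∈ₜ y)) : p ⊩ Incl x y := allI fun z => impI (h z)

theorem Forces.void (h : p ⊩ Void x) (hz : p ⊩ z ∈ₜ x) : p ⊩ C := (h.allE z).absurd hz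

theorem void_eq (hx : p ⊩ Void x) (hy : p ⊩ Void y) : p ⊩ x =ₜ y :=
  hx.bind fun hx => hy.bind fun hy => extensionality (fun _ h => hx.void h) (fun _ h => hy.void h)

theorem Forces.sing (h : p ⊩ Sing s x) : p ⊩ x ∈ₜ s := (h.allE x).iffE' (eq_refl x)

theorem Forces.sing_eq (h : p ⊩ Sing s x) (hz : p ⊩ z ∈ₜ s) : p ⊩ z =ₜ x := (h.allE z).iffE hz

theorem Forces.sing_unique (h : p ⊩ Sing s x) (h' : p ⊩ Sing t x) : p ⊩ s =ₜ t :=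
  h.bind fun h => h'.bind fun h' => extensionality (fun _ hz => (h.sing_eq hz).symm.memL h'.sing)
    (fun _ hz => (h'.sing_eq hz).symm.memL h.sing)

theorem Forces.adj_old (h : p ⊩ Adj y x a) (hz : p ⊩ z ∈ₜ x) : p ⊩ z ∈ₜ y :=
  (h.allE z).iffE' hz.inl

theorem Forces.adj_new (h : p ⊩ Adj y x a) : p ⊩ a ∈ₜ y := (h.allE a).iffE' (eq_refl a).inr

theorem Forces.adj_cases (h : p ⊩ Adj y x a) (hz : p ⊩ z ∈ₜ y)
    (h₁ : ∀ {q : World} [Le p q], (∀ {r : World} [Le q r], r ⊩ z ∈ₜ x) → (q ⊩ C))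
    (h₂ : ∀ {q : World} [Le p q], (∀ {r : World} [Le q r], r ⊩ z =ₜ a) → (q ⊩ C)) : p ⊩ C :=
  ((h.allE z).iffE hz).cases h₁ h₂

theorem adj_intro (hxy : p ⊩ Incl x y) (ha : p ⊩ a ∈ₜ y)
    (h : ∀ {q : World} [Le p q] (z : ℕ), (∀ {r : World} [Le q r], r ⊩ z ∈ₜ y) →
      (q ⊩ z ∈ₜ x ∨ₜ z =ₜ a)) : p ⊩ Adj y x a :=
  hxy.bind fun hxy => ha.bind fun ha => allI fun z => iffI (h z) fun hz =>
    hz.cases (fun hz => hxy.incl hz) fun hz => hz.symm.memL ha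

theorem exists_adj (x a : ℕ) (p : World) : p ⊩ .ex fun y => Adj y x a :=
  comprehension (0 ∊ 1 ⋎ 0 ≐ 2) (push 0 (push 1 fun _ => 0)) (push x (push a id))
    ⟨rfl, rfl⟩ p

theorem Forces.adj_unique (h : p ⊩ Adj y x a) (h' : p ⊩ Adj z x a) : p ⊩ y =ₜ z :=
  h.bind fun h => h'.bind fun h' => extensionality
    (fun _ hw => h.adj_cases hw (fun hw => h'.adj_old hw) fun hw => hw.symm.memL h'.adj_new)
    (fun _ hw => h'.adj_cases hw (fun hw => h.adj_old hw) fun hw => hw.symm.memL h.adj_new)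

theorem Forces.adj_congr (h : p ⊩ Adj y x a) (ha : p ⊩ a =ₜ b) : p ⊩ Adj y x b :=
  eq_subst (isAdjoin 1 2 0) (push y (push x id)) ha h

/-- Removing a new element from `x ∪ {a}` gives `x`. -/
theorem Forces.adj_cancel (h : p ⊩ Adj y x a) (h' : p ⊩ Adj y z a) (hx : p ⊩ ¬ₜ (a ∈ₜ x))
    (hz : p ⊩ ¬ₜ (a ∈ₜ z)) : p ⊩ x =ₜ z :=
  h.bind fun h => h'.bind fun h' => hx.bind fun hx => hz.bind fun hz => extensionality
    (fun _ hw => h'.adj_cases (h.adj_old hw) (fun hw => hw) fun e => hx.absurd (e.memL hw))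
    (fun _ hw => h.adj_cases (h'.adj_old hw) (fun hw => hw) fun e => hz.absurd (e.memL hw))

theorem Forces.part (h : p ⊩ Part u x) (hz : p ⊩ z ∈ₜ u) : p ⊩ z ∈ₜ x := h.left.incl hz

theorem Forces.part_cases (h : p ⊩ Part u x) (hz : p ⊩ z ∈ₜ x)
    (h₁ : ∀ {q : World} [Le p q], (∀ {r : World} [Le q r], r ⊩ z ∈ₜ u) → (q ⊩ C))
    (h₂ : ∀ {q : World} [Le p q], (∀ {r : World} [Le q r], r ⊩ ¬ₜ (z ∈ₜ u)) → (q ⊩ C)) : p ⊩ C :=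
  ((h.right.allE z).iffE hz).cases h₁ fun h => h₂ h.right

theorem part_intro (hux : p ⊩ Incl u x)
    (h : ∀ {q : World} [Le p q] (z : ℕ), (∀ {r : World} [Le q r], r ⊩ z ∈ₜ x) →
      (q ⊩ z ∈ₜ u ∨ₜ ¬ₜ (z ∈ₜ u))) : p ⊩ Part u x :=
  hux.bind fun hux => andI hux <| allI fun z => iffI
    (fun hz => (h z hz).cases (fun h => h.inl) fun h => (andI hz h).inr)
    fun h => h.cases (fun h => hux.incl h) fun h => h.left

theorem part_refl (x : ℕ) : p ⊩ Part x x := part_intro (incl_intro fun _ h => h) fun _ h => h.inl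

theorem part_void (hu : p ⊩ Void u) : p ⊩ Part u x :=
  hu.bind fun hu => part_intro (incl_intro fun _ h => hu.void h)
    fun _ _ => inr (negI fun h => hu.void h)

theorem Forces.part_trans (h : p ⊩ Part u x) (h' : p ⊩ Part x y) : p ⊩ Part u y :=
  h.bind fun h => h'.bind fun h' => part_intro (incl_intro fun _ hz => h'.part (h.part hz))
    fun _ hz => h'.part_cases hz (fun hz => h.part_cases hz (fun hz => hz.inl) fun hz => hz.inr)
      fun hz => inr (negI fun h'' => hz.absurd (h.part h''))

theorem Forces.part_adj (h : p ⊩ Part u x) (hu : p ⊩ Adj w u a) (hx : p ⊩ Adj y x a)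
    (ha : p ⊩ ¬ₜ (a ∈ₜ x)) : p ⊩ Part w y :=
  h.bind fun h => hu.bind fun hu => hx.bind fun hx => ha.bind fun ha => part_intro
    (incl_intro fun _ hz => hu.adj_cases hz (fun hz => hx.adj_old (h.part hz))
      fun e => e.symm.memL hx.adj_new)
    fun _ hz => hx.adj_cases hz
      (fun hzx => h.part_cases hzx (fun hz => (hu.adj_old hz).inl) fun hz => inr <| negI fun h' =>
        hu.adj_cases h' (fun h' => hz.absurd h') fun e => ha.absurd (e.memL hzx))
      fun e => inl (e.symm.memL hu.adj_new)

end

-- Unfolding these reduces stratification goals to equations between concrete types.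
attribute [local simp] StratifiedBy neg Fml.iff push isAdjoin isZero isFiniteCardinal isSucc isEmpty
  inhabited subset splits isSingleton isPair isOrderedPair pairMem isFunction isUSC isSSC mapsTo
  isOneToOne isOnto similar

/-! ### Finite cardinals -/

section

variable {p : World} {C : Truth} {a b c d j k l m n s t u w x y z : ℕ}

theorem exists_zeroCard (p : World) : p ⊩ .ex fun z => ZeroCard z :=
  comprehension (isEmpty 0) (fun _ => 1) id ⟨0, rfl, trivial⟩ p

theorem exists_succCard (k : ℕ) (p : World) : p ⊩ .ex fun s => SuccCard s k :=
  comprehension (ex (ex (1 ∊ 3 ⋏ neg (0 ∊ 1) ⋏ isAdjoin 2 1 0))) (push 1 fun _ => 2)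
    (push k id) (by simp) p

theorem Forces.succ_intro (h : p ⊩ SuccCard s k) (hz : p ⊩ z ∈ₜ k) (ha : p ⊩ ¬ₜ (a ∈ₜ z))
    (hx : p ⊩ Adj x z a) : p ⊩ x ∈ₜ s :=
  (h.allE x).iffE' (exI z (exI a (andI hz (andI ha hx))))

theorem Forces.succ_elim (h : p ⊩ SuccCard s k) (hx : p ⊩ x ∈ₜ s)
    (hC : ∀ {q : World} [Le p q] (z a : ℕ), (∀ {r : World} [Le q r], r ⊩ z ∈ₜ k) →
      (∀ {r : World} [Le q r], r ⊩ ¬ₜ (a ∈ₜ z)) → (∀ {r : World} [Le q r], r ⊩ Adj x z a) →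
      (q ⊩ C)) : p ⊩ C :=
  ((h.allE x).iffE hx).exE fun z h => h.exE fun a h => hC z a h.left h.right.left h.right.right

theorem Forces.zero (h : p ⊩ ZeroCard z) (hx : p ⊩ x ∈ₜ z) : p ⊩ Void x := (h.allE x).iffE hx

theorem zero_unique (h : p ⊩ ZeroCard z) (h' : p ⊩ ZeroCard w) : p ⊩ z =ₜ w :=
  h.bind fun h => h'.bind fun h' => extensionality (fun x hx => (h'.allE x).iffE' (h.zero hx))
    fun x hx => (h.allE x).iffE' (h'.zero hx)

theorem succ_unique (h : p ⊩ SuccCard s k) (h' : p ⊩ SuccCard t l) (hkl : p ⊩ k =ₜ l) :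
    p ⊩ s =ₜ t :=
  h.bind fun h => h'.bind fun h' => hkl.bind fun hkl => extensionality
    (fun _ hx => h.succ_elim hx fun _ _ hz ha hx => h'.succ_intro (hkl.memR hz) ha hx)
    (fun _ hx => h'.succ_elim hx fun _ _ hz ha hx => h.succ_intro (hkl.symm.memR hz) ha hx)

theorem Forces.zero_fin (h : p ⊩ ZeroCard z) : p ⊩ FinCard z :=
  h.bind fun h => allI fun _ => impI fun hw => hw.left.exE fun _ hz' =>
    (zero_unique hz'.left h).memL hz'.right

theorem Forces.succ_fin (h : p ⊩ SuccCard s k) (hk : p ⊩ FinCard k) (hs : p ⊩ Inh s) :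
    p ⊩ FinCard s :=
  h.bind fun h => hk.bind fun hk => hs.bind fun hs => allI fun w => impI fun hw =>
    ((hw.right.allE k).allE s).mp h |>.mp (andI ((hk.allE w).mp hw) hs)

/-- Comprehension forms the set of finite cardinals satisfying `φ`, and this is one of the sets `w`
intersected in the definition of 𝔽. Including `isFiniteCardinal` in it makes `FinCard k` available
in the successor step. -/
theorem induction {P : ℕ → Truth} (φ : Fml) (τ σ : ℕ → ℕ)
    (hφ : (isFiniteCardinal 0 ⋏ φ).StratifiedBy τ) (hP : ∀ x, φ.eval (push x σ) = P x)
    (zero : ∀ {q : World} [Le p q] (z : ℕ), (∀ {r : World} [Le q r], r ⊩ ZeroCard z) → (q ⊩ P z))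
    (succ : ∀ {q : World} [Le p q] (k s : ℕ), (∀ {r : World} [Le q r], r ⊩ FinCard k) →
      (∀ {r : World} [Le q r], r ⊩ SuccCard s k) → (∀ {r : World} [Le q r], r ⊩ P k) → (q ⊩ P s))
    (hk : p ⊩ FinCard k) : p ⊩ P k := by
  obtain rfl : (fun x => φ.eval (push x σ)) = P := funext hP
  have hw : p ⊩ .ex fun w => .all fun x => x ∈ₜ w ↔ₜ (FinCard x ∧ₜ φ.eval (push x σ)) :=
    comprehension _ τ σ hφ p
  refine hk.bind fun hk => hw.exE fun w hw => ?_
  refine ((hw.allE k).iffE ((hk.allE w).mp (andI ?_ ?_))).right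
  · exact (exists_zeroCard _).exE fun z hz => exI z (andI hz ((hw.allE z).iffE' (andI hz.zero_fin
      (zero z hz))))
  · refine allI fun m => allI fun s => impI fun hs => impI fun hm => (hw.allE s).iffE' ?_
    refine ((hw.allE m).iffE hm.left).bind fun hm' => andI (hs.succ_fin hm'.left hm.right) ?_
    exact succ m s hm'.left hs hm'.right

theorem Forces.finCard_cases (hk : p ⊩ FinCard k)
    (h₁ : ∀ {q : World} [Le p q], (∀ {r : World} [Le q r], r ⊩ ZeroCard k) → (q ⊩ C))
    (h₂ : ∀ {q : World} [Le p q] (m : ℕ), (∀ {r : World} [Le q r], r ⊩ FinCard m) →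
      (∀ {r : World} [Le q r], r ⊩ SuccCard k m) → (q ⊩ C)) : p ⊩ C := by
  have key : p ⊩ ZeroCard k ∨ₜ .ex fun m => FinCard m ∧ₜ SuccCard k m :=
    induction (P := fun k => ZeroCard k ∨ₜ .ex fun m => FinCard m ∧ₜ SuccCard k m)
      (isZero 0 ⋎ ex (isFiniteCardinal 0 ⋏ isSucc 1 0)) (fun _ => 2) id
      (by simp) (fun _ => rfl)
      (fun z hz => hz.inl) (fun k s hk hs _ => inr (exI k (andI hk hs))) hk
  exact key.cases h₁ fun h => h.exE fun m h => h₂ m h.left h.right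


/-- Any element of a set in `k⁺` may be taken for the last one adjoined. -/
theorem Forces.succ_remove (hk : p ⊩ FinCard k) (hs : p ⊩ SuccCard s k) (hx : p ⊩ x ∈ₜ s)
    (hc : p ⊩ c ∈ₜ x)
    (hC : ∀ {q : World} [Le p q] (y : ℕ), (∀ {r : World} [Le q r], r ⊩ y ∈ₜ k) →
      (∀ {r : World} [Le q r], r ⊩ ¬ₜ (c ∈ₜ y)) → (∀ {r : World} [Le q r], r ⊩ Adj x y c) →
      (q ⊩ C)) : p ⊩ C := by
  have key : p ⊩ .all fun s => .all fun x => .all fun c => SuccCard s k →ₜ (x ∈ₜ s ∧ₜ c ∈ₜ x) →ₜ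
      .ex fun y => y ∈ₜ k ∧ₜ ¬ₜ (c ∈ₜ y) ∧ₜ Adj x y c := by
    refine induction (P := fun k => .all fun s => .all fun x => .all fun c => SuccCard s k →ₜ
        (x ∈ₜ s ∧ₜ c ∈ₜ x) →ₜ .ex fun y => y ∈ₜ k ∧ₜ ¬ₜ (c ∈ₜ y) ∧ₜ Adj x y c)
      (all (all (all (isSucc 2 3 ⇒ (1 ∊ 2 ⋏ 0 ∊ 1) ⇒
        ex (0 ∊ 4 ⋏ neg (1 ∊ 0) ⋏ isAdjoin 2 0 1)))))
      (fun _ => 2) id (by simp) (fun _ => rfl) ?_ ?_ hk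
    · refine fun k hk => allI fun s => allI fun x => allI fun c => impI fun hs => impI fun h =>
        hs.succ_elim h.left fun z a hz ha hx => hx.adj_cases h.right
          (fun hc => (hk.zero hz).void hc) fun e => ?_
      exact exI z (andI hz (andI (negI fun h => ha.absurd (e.memL h)) (hx.adj_congr e.symm)))
    · refine fun k t hk ht ih => allI fun s => allI fun x => allI fun c => impI fun hs =>
        impI fun h => hs.succ_elim h.left fun z a hz ha hx => hx.adj_cases h.right
          (fun hc => ?_) fun e => ?_
      -- Here `c ∈ z`: remove `c` from `z` by the inductive hypothesis, then put `a` back.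
      · refine ((((ih.allE t).allE z).allE c).mp ht).mp (andI hz hc) |>.exE fun y hy =>
          hy.left.bind fun hyk => hy.right.left.bind fun hcy => hy.right.right.bind fun hzy =>
          (exists_adj y a _).exE fun y' hy' => exI y' (andI (ht.succ_intro hyk
            (negI fun h => ha.absurd (hzy.adj_old h)) hy') (andI ?_ ?_))
        · exact negI fun h => hy'.adj_cases h (fun h => hcy.absurd h) fun e => ha.absurd (e.memL hc)
        · refine adj_intro (incl_intro fun w hw => ?_) (hx.adj_old hc) fun w hw => ?_
          · exact hy'.adj_cases hw (fun h => hx.adj_old (hzy.adj_old h))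
              fun e => e.symm.memL hx.adj_new
          · exact hx.adj_cases hw (fun hw => hzy.adj_cases hw (fun h => (hy'.adj_old h).inl)
              fun e => e.inr) fun e => inl (e.symm.memL hy'.adj_new)
      · exact exI z (andI hz (andI (negI fun h => ha.absurd (e.memL h)) (hx.adj_congr e.symm)))
  exact ((((key.allE s).allE x).allE c).mp hs).mp (andI hx hc) |>.exE fun y hy =>
    hC y hy.left hy.right.left hy.right.right

/-- Finite cardinals with a common member are equal. -/
theorem finCard_unique (hk : p ⊩ FinCard k) (hl : p ⊩ FinCard l) (hu : p ⊩ u ∈ₜ k)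
    (hu' : p ⊩ u ∈ₜ l) : p ⊩ k =ₜ l := by
  have key : p ⊩ .all fun l => .all fun u => FinCard l →ₜ (u ∈ₜ k ∧ₜ u ∈ₜ l) →ₜ k =ₜ l := by
    refine induction
      (P := fun k => .all fun l => .all fun u => FinCard l →ₜ (u ∈ₜ k ∧ₜ u ∈ₜ l) →ₜ k =ₜ l)
      (all (all (isFiniteCardinal 1 ⇒ (0 ∊ 2 ⋏ 0 ∊ 1) ⇒ 2 ≐ 1)))
      (fun _ => 2) id (by simp) (fun _ => rfl) ?_ ?_ hk
    · refine fun k hk => allI fun l => allI fun u => impI fun hl => impI fun h =>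
        hl.finCard_cases (fun hl => zero_unique hk hl) fun m hm hlm => ?_
      exact hlm.succ_elim h.right fun z a hz ha hx => (hk.zero h.left).void hx.adj_new
    · refine fun k s hk hs ih => allI fun l => allI fun u => impI fun hl => impI fun h =>
        hs.succ_elim h.left fun z a hz ha hx => hl.finCard_cases (fun hl => ?_) fun m hm hlm => ?_
      · exact (hl.zero h.right).void hx.adj_new
      -- On the side of `l`, too, `a` may be taken as adjoined last; cancelling it shows that both
      -- predecessors contain `z`.
      · refine hm.succ_remove hlm h.right hx.adj_new fun y hy hay hxy => ?_
        refine succ_unique hs hlm ((((ih.allE m).allE z).mp hm).mp (andI hz ?_))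
        exact (hxy.adj_cancel hx hay ha).memL hy
  exact (((key.allE l).allE u).mp hl).mp (andI hu hu')

/-- A subset of a finite set with the same cardinal is the whole set. -/
theorem incl_of_incl (hk : p ⊩ FinCard k) (hx : p ⊩ x ∈ₜ k) (hy : p ⊩ y ∈ₜ k)
    (hyx : p ⊩ Incl y x) : p ⊩ Incl x y := by
  have key : p ⊩ .all fun x => .all fun y => (x ∈ₜ k ∧ₜ y ∈ₜ k ∧ₜ Incl y x) →ₜ Incl x y := by
    refine induction
      (P := fun k => .all fun x => .all fun y => (x ∈ₜ k ∧ₜ y ∈ₜ k ∧ₜ Incl y x) →ₜ Incl x y)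
      (all (all ((1 ∊ 2 ⋏ 0 ∊ 2 ⋏ subset 0 1) ⇒ subset 1 0)))
      (fun _ => 2) id (by simp) (fun _ => rfl) ?_ ?_ hk
    · exact fun k hk => allI fun x => allI fun y => impI fun h =>
        incl_intro fun z hz => (hk.zero h.left).void hz
    · refine fun k s hk hs ih => allI fun x => allI fun y => impI fun h =>
        hs.succ_elim h.right.left fun z a hz ha hy => ?_
      -- The point `a` adjoined last to `y` lies in `x`; it is removed from both sets.
      refine h.right.right.bind fun hyx => hk.succ_remove hs h.left (hyx.incl hy.adj_new)
        fun x' hx' hax hx => ?_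
      refine (((ih.allE x').allE z).mp (andI hx' (andI hz (incl_intro fun w hw =>
        hx.adj_cases (hyx.incl (hy.adj_old hw)) (fun h => h) fun e => ha.absurd (e.memL hw))))).bind
        fun hxz => ?_
      exact incl_intro fun w hw => hx.adj_cases hw (fun hw => hy.adj_old (hxz.incl hw))
        fun e => e.symm.memL hy.adj_new
  exact ((key.allE x).allE y).mp (andI hx (andI hy hyx))

/-- Inclusion of a finite set in a set that is decidable on it is decidable. -/
theorem incl_decidable (hk : p ⊩ FinCard k) (hx : p ⊩ x ∈ₜ k)
    (hy : p ⊩ .all fun z => z ∈ₜ x →ₜ (z ∈ₜ y ∨ₜ ¬ₜ (z ∈ₜ y))) :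
    p ⊩ Incl x y ∨ₜ ¬ₜ (Incl x y) := by
  have key : p ⊩ .all fun x => .all fun y => x ∈ₜ k →ₜ
      (.all fun z => z ∈ₜ x →ₜ (z ∈ₜ y ∨ₜ ¬ₜ (z ∈ₜ y))) →ₜ (Incl x y ∨ₜ ¬ₜ (Incl x y)) := by
    refine induction (P := fun k => .all fun x => .all fun y => x ∈ₜ k →ₜ
        (.all fun z => z ∈ₜ x →ₜ (z ∈ₜ y ∨ₜ ¬ₜ (z ∈ₜ y))) →ₜ (Incl x y ∨ₜ ¬ₜ (Incl x y)))
      (all (all (1 ∊ 2 ⇒ (all (0 ∊ 2 ⇒ (0 ∊ 1 ⋎ neg (0 ∊ 1)))) ⇒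
        (subset 1 0 ⋎ neg (subset 1 0)))))
      (fun _ => 2) id (by simp) (fun _ => rfl) ?_ ?_ hk
    · exact fun k hk => allI fun x => allI fun y => impI fun hx => impI fun _ =>
        inl (incl_intro fun z hz => (hk.zero hx).void hz)
    · refine fun k s hk hs ih => allI fun x => allI fun y => impI fun hx => impI fun h =>
        hs.succ_elim hx fun z a hz ha hx => ((h.allE a).mp hx.adj_new).cases (fun hay => ?_)
          fun hay => inr (negI fun h => hay.absurd (h.incl hx.adj_new))
      refine (((ih.allE z).allE y).mp hz).mp (allI fun w => impI fun hw =>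
        (h.allE w).mp (hx.adj_old hw)) |>.cases (fun hzy => inl (incl_intro fun w hw => ?_))
          fun hzy => inr (negI fun h => hzy.absurd (incl_intro fun w hw => h.incl (hx.adj_old hw)))
      exact hx.adj_cases hw (fun hw => hzy.incl hw) fun e => e.symm.memL hay
  exact (((key.allE x).allE y).mp hx).mp hy

/-- Of two finite sets, one is equipotent to a part of the other. -/
theorem part_total (hn : p ⊩ FinCard n) (hm : p ⊩ FinCard m) (hx : p ⊩ x ∈ₜ n)
    (hy : p ⊩ y ∈ₜ m) :
    p ⊩ (.ex fun u => u ∈ₜ m ∧ₜ Part u x) ∨ₜ .ex fun u => u ∈ₜ n ∧ₜ Part u y := by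
  have key : p ⊩ .all fun x => .all fun m => .all fun y => x ∈ₜ n →ₜ FinCard m →ₜ y ∈ₜ m →ₜ
      ((.ex fun u => u ∈ₜ m ∧ₜ Part u x) ∨ₜ .ex fun u => u ∈ₜ n ∧ₜ Part u y) := by
    refine induction
      (P := fun n => .all fun x => .all fun m => .all fun y => x ∈ₜ n →ₜ FinCard m →ₜ y ∈ₜ m →ₜ
        ((.ex fun u => u ∈ₜ m ∧ₜ Part u x) ∨ₜ .ex fun u => u ∈ₜ n ∧ₜ Part u y))
      (all (all (all (2 ∊ 3 ⇒ isFiniteCardinal 1 ⇒ 0 ∊ 1 ⇒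
        (ex (0 ∊ 2 ⋏ subset 0 3 ⋏ splits 0 3) ⋎ ex (0 ∊ 4 ⋏ subset 0 1 ⋏ splits 0 1))))))
      (fun _ => 2) id (by simp) (fun _ => rfl) ?_ ?_ hn
    · exact fun n hn => allI fun x => allI fun m => allI fun y => impI fun hx => impI fun _ =>
        impI fun _ => inr (exI x (andI hx (part_void (hn.zero hx))))
    · refine fun n s hn hs ih => allI fun x => allI fun m => allI fun y => impI fun hx =>
        impI fun hm => impI fun hy => hs.succ_elim hx fun z a hz ha hx => hm.finCard_cases
          (fun hm => inl (exI y (andI hy (part_void (hm.zero hy))))) fun k hk hmk =>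
        hmk.succ_elim hy fun w b hw hb hy => ?_
      refine (((((ih.allE z).allE k).allE w).mp hz).mp hk).mp hw |>.cases
        (fun h => inl (h.exE fun u hu => ?_)) (fun h => inr (h.exE fun u hu => ?_))
      · exact (exists_adj u a _).exE fun v hv => exI v (andI (hmk.succ_intro hu.left
          (negI fun h => ha.absurd (hu.right.part h)) hv) (hu.right.part_adj hv hx ha))
      · exact (exists_adj u b _).exE fun v hv => exI v (andI (hs.succ_intro hu.left
          (negI fun h => hb.absurd (hu.right.part h)) hv) (hu.right.part_adj hv hy hb))
  exact (((((key.allE x).allE m).allE y).mp hx).mp hm).mp hy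

/-- If a set in `n` has a part in `m`, then so does every set in `n`. -/
theorem exists_part (hn : p ⊩ FinCard n) (hm : p ⊩ FinCard m) (ha : p ⊩ a ∈ₜ m) (hb : p ⊩ b ∈ₜ n)
    (hab : p ⊩ Part a b) (hx : p ⊩ x ∈ₜ n) : p ⊩ .ex fun u => u ∈ₜ m ∧ₜ Part u x := by
  refine hn.bind fun hn => hm.bind fun hm => ha.bind fun ha => hb.bind fun hb =>
    hab.bind fun hab => hx.bind fun hx => (part_total hn hm hx ha).cases (fun h => h) fun h =>
    h.exE fun u hu => ?_
  -- Here `u ⊆ a ⊆ b` with `u` and `b` both in `n`. So `a = b` and `n = m`, and `x` serves as a part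
  -- of itself.
  refine (incl_of_incl hn hb hu.left (hu.right.part_trans hab).left).bind fun hbu =>
    exI x (andI ?_ (part_refl x))
  refine (finCard_unique hn hm hb (memL (extensionality (x := a) (fun _ hz => hab.part hz)
    fun _ hz => hu.right.part (hbu.incl hz)) ha)).memR hx

end

/-! ### Sums of finite cardinals -/

def Disj (x y : ℕ) : Truth := .all fun z => z ∈ₜ x →ₜ ¬ₜ (z ∈ₜ y)

def Union (u x y : ℕ) : Truth := .all fun z => z ∈ₜ u ↔ₜ (z ∈ₜ x ∨ₜ z ∈ₜ y)

/-- `v = { u ∪ {c} : u ∈ w }` -/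
def AdjImage (v w c : ℕ) : Truth := .all fun y => y ∈ₜ v ↔ₜ .ex fun u => u ∈ₜ w ∧ₜ Adj y u c

/-- `SSC(d) ∈ k` for all `d` with `USC(d) ∈ m`. -/
def PowBound (k m : ℕ) : Truth :=
  .all fun d => .all fun w => .all fun s => Usc w d →ₜ w ∈ₜ m →ₜ Ssc s d →ₜ s ∈ₜ k

/-- `f` restricts to a bijection of `x` with `y`. -/
def Biject (f x y : ℕ) : Truth :=
  (.all fun a => a ∈ₜ x →ₜ .ex fun b => b ∈ₜ y ∧ₜ PairMem a b f) ∧ₜ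
  (.all fun b => b ∈ₜ y →ₜ .ex fun a => a ∈ₜ x ∧ₜ PairMem a b f) ∧ₜ
  Func f ∧ₜ .all fun a => .all fun a' => .all fun b =>
    (a ∈ₜ x ∧ₜ a' ∈ₜ x ∧ₜ PairMem a b f ∧ₜ PairMem a' b f) →ₜ a =ₜ a'

section

variable {p : World} {C : Truth} {a b c d e f j k l m n s t u v w x y z : ℕ}

theorem exists_union (x y : ℕ) (p : World) : p ⊩ .ex fun u => Union u x y :=
  comprehension (0 ∊ 1 ⋎ 0 ∊ 2) (push 0 fun _ => 1) (push x (push y id)) (by simp) p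

theorem exists_adjImage (w c : ℕ) (p : World) : p ⊩ .ex fun v => AdjImage v w c :=
  comprehension (ex (0 ∊ 2 ⋏ isAdjoin 1 0 3)) (push 1 (push 2 fun _ => 0)) (push w (push c id))
    (by simp) p

/-- The sum of two finite cardinals, provided that it has a member. -/
theorem exists_sum (hk : p ⊩ FinCard k) (hl : p ⊩ FinCard l) (hx : p ⊩ x ∈ₜ k) (hy : p ⊩ y ∈ₜ l)
    (hxy : p ⊩ Disj x y) : p ⊩ .ex fun s => FinCard s ∧ₜ .all fun x => .all fun y => .all fun u =>
      x ∈ₜ k →ₜ y ∈ₜ l →ₜ Disj x y →ₜ Union u x y →ₜ u ∈ₜ s := by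
  have key : p ⊩ .all fun x => .all fun y => .all fun k => FinCard k →ₜ x ∈ₜ k →ₜ y ∈ₜ l →ₜ
      Disj x y →ₜ .ex fun s => FinCard s ∧ₜ .all fun x => .all fun y => .all fun u =>
        x ∈ₜ k →ₜ y ∈ₜ l →ₜ Disj x y →ₜ Union u x y →ₜ u ∈ₜ s := by
    refine induction (P := fun l => .all fun x => .all fun y => .all fun k => FinCard k →ₜ
        x ∈ₜ k →ₜ y ∈ₜ l →ₜ Disj x y →ₜ .ex fun s => FinCard s ∧ₜ .all fun x => .all fun y =>
          .all fun u => x ∈ₜ k →ₜ y ∈ₜ l →ₜ Disj x y →ₜ Union u x y →ₜ u ∈ₜ s)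
      (all (all (all (isFiniteCardinal 0 ⇒ 2 ∊ 0 ⇒ 1 ∊ 3 ⇒ (all (0 ∊ 3 ⇒ neg (0 ∊ 2))) ⇒
        ex (isFiniteCardinal 0 ⋏ all (all (all (2 ∊ 4 ⇒ 1 ∊ 7 ⇒ (all (0 ∊ 3 ⇒ neg (0 ∊ 2))) ⇒
          (all (0 ∊ 1 ⇔ (0 ∊ 3 ⋎ 0 ∊ 2))) ⇒ 0 ∊ 3))))))))
      (fun _ => 2) id (by simp) (fun _ => rfl) ?_ ?_ hl
    · refine fun l hl => allI fun x => allI fun y => allI fun k => impI fun hk => impI fun hx =>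
        impI fun hy => impI fun hxy => exI k (andI hk (allI fun x => allI fun y => allI fun u =>
          impI fun hx => impI fun hy => impI fun hxy => impI fun hu => ?_))
      exact memL (extensionality (x := x) (fun z hz => (hu.allE z).iffE' hz.inl) fun z hz =>
        ((hu.allE z).iffE hz).cases (fun h => h) fun h => (hl.zero hy).void h) hx
    · refine fun l t hl ht ih => allI fun x => allI fun y => allI fun k => impI fun hk =>
        impI fun hx => impI fun hy => impI fun hxy => ht.succ_elim hy fun y' c hy' hc hy => ?_
      refine ((((((ih.allE x).allE y').allE k).mp hk).mp hx).mp hy').mp (allI fun z =>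
        impI fun hz => negI fun hz' => ((hxy.allE z).mp hz).absurd (hy.adj_old hz'))
        |>.exE fun s hs => (exists_succCard s _).exE fun s' hs' => ?_
      -- A successor is known to be a finite cardinal only when inhabited; the given disjoint pair
      -- provides a member.
      refine exI s' (andI (hs'.succ_fin hs.left ?_) ?_)
      · refine (exists_union x y' _).exE fun u hu => (exists_adj u c _).exE fun v hv =>
          exI v (hs'.succ_intro ?_ (negI fun h => ?_) hv)
        · refine (((((hs.right.allE x).allE y').allE u).mp hx).mp hy').mp (allI fun z =>
            impI fun hz => negI fun hz' => ((hxy.allE z).mp hz).absurd (hy.adj_old hz')) |>.mp hu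
        · exact ((hu.allE c).iffE h).cases (fun h => ((hxy.allE c).mp h).absurd hy.adj_new)
            fun h => hc.absurd h
      · refine allI fun x => allI fun y => allI fun v => impI fun hx => impI fun hy =>
          impI fun hxy => impI fun hv => ht.succ_elim hy fun y' c hy' hc hy =>
          (exists_union x y' _).exE fun u hu => hs'.succ_intro (z := u) (a := c) ?_
            (negI fun h => ?_) ?_
        · refine (((((hs.right.allE x).allE y').allE u).mp hx).mp hy').mp (allI fun z =>
            impI fun hz => negI fun hz' => ((hxy.allE z).mp hz).absurd (hy.adj_old hz')) |>.mp hu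
        · exact ((hu.allE c).iffE h).cases (fun h => ((hxy.allE c).mp h).absurd hy.adj_new)
            fun h => hc.absurd h
        · refine adj_intro (incl_intro fun z hz => (hv.allE z).iffE' ?_)
            ((hv.allE c).iffE' hy.adj_new.inr) fun z hz => ?_
          · exact ((hu.allE z).iffE hz).cases (fun h => h.inl) fun h => (hy.adj_old h).inr
          · exact ((hv.allE z).iffE hz).cases (fun h => inl ((hu.allE z).iffE' h.inl)) fun h =>
              hy.adj_cases h (fun h => inl ((hu.allE z).iffE' h.inr)) fun h => h.inr
  exact ((((((key.allE x).allE y).allE k).mp hk).mp hx).mp hy).mp hxy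

/-- The map `u ↦ u ∪ {c}` is injective on `w`, since `c` can be removed again. Induction avoids
coding the map as a set of pairs. -/
theorem adjImage_mem (hk : p ⊩ FinCard k) (hw : p ⊩ w ∈ₜ k)
    (hc : p ⊩ .all fun u => u ∈ₜ w →ₜ ¬ₜ (c ∈ₜ u)) (hv : p ⊩ AdjImage v w c) : p ⊩ v ∈ₜ k := by
  have key : p ⊩ .all fun w => .all fun c => .all fun v => w ∈ₜ k →ₜ
      (.all fun u => u ∈ₜ w →ₜ ¬ₜ (c ∈ₜ u)) →ₜ AdjImage v w c →ₜ v ∈ₜ k := by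
    refine induction (P := fun k => .all fun w => .all fun c => .all fun v => w ∈ₜ k →ₜ
        (.all fun u => u ∈ₜ w →ₜ ¬ₜ (c ∈ₜ u)) →ₜ AdjImage v w c →ₜ v ∈ₜ k)
      (all (all (all (2 ∊ 3 ⇒ (all (0 ∊ 3 ⇒ neg (2 ∊ 0))) ⇒
        (all (0 ∊ 1 ⇔ ex (0 ∊ 4 ⋏ isAdjoin 1 0 3))) ⇒ 0 ∊ 3))))
      -- The type is 3 because the members of `k` are here sets of sets.
      (fun _ => 3) id (by simp) (fun _ => rfl) ?_ ?_ hk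
    · exact fun k hk => allI fun w => allI fun c => allI fun v => impI fun hw => impI fun _ =>
        impI fun hv => (hk.allE v).iffE' (allI fun y => negI fun hy => ((hv.allE y).iffE hy).exE
          fun u hu => (hk.zero hw).void hu.left)
    · refine fun k s hk hs ih => allI fun w => allI fun c => allI fun v => impI fun hw =>
        impI fun hc => impI fun hv => hs.succ_elim hw fun w' a hw' ha hw =>
        (exists_adjImage w' c _).exE fun v' hv' => (exists_adj a c _).exE fun b hb =>
        hs.succ_intro (z := v') (a := b) ?_ (negI fun h => ?_) ?_
      · exact (((((ih.allE w').allE c).allE v').mp hw').mp (allI fun u => impI fun hu =>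
          (hc.allE u).mp (hw.adj_old hu))).mp hv'
      · exact ((hv'.allE b).iffE h).exE fun u hu => ha.absurd ((hu.right.adj_cancel hb
          ((hc.allE u).mp (hw.adj_old hu.left)) ((hc.allE a).mp hw.adj_new)).memL hu.left)
      · refine adj_intro (incl_intro fun y hy => (hv.allE y).iffE' ?_)
          ((hv.allE b).iffE' (exI a (andI hw.adj_new hb))) fun y hy => ?_
        · exact ((hv'.allE y).iffE hy).exE fun u hu =>
            exI u (andI (hw.adj_old hu.left) hu.right)
        · refine ((hv.allE y).iffE hy).exE fun u hu => hw.adj_cases hu.left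
            (fun h => inl ((hv'.allE y).iffE' (exI u (andI h hu.right)))) fun h => inr ?_
          -- The formula reads `y = u ∪ {c} → y = b`; it holds with `a` in place of `u`, by
          -- uniqueness, and is carried along `a = u`.
          exact eq_subst (isAdjoin 1 0 2 ⇒ 1 ≐ 3) (push y (push c (push b id))) h.symm
            (impI fun hy => hy.adj_unique hb) |>.mp hu.right
  exact (((((key.allE w).allE c).allE v).mp hw).mp hc).mp hv

/-! ### Sets of singletons and of separated subsets -/

theorem exists_sing (x : ℕ) (p : World) : p ⊩ .ex fun s => Sing s x :=
  comprehension (0 ≐ 1) (fun _ => 0) (push x id) rfl p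

theorem exists_ssc (a : ℕ) (p : World) : p ⊩ .ex fun s => Ssc s a :=
  comprehension (subset 0 1 ⋏ splits 0 1) (fun _ => 1) (push a id) (by simp) p

theorem Forces.usc_intro (h : p ⊩ Usc w a) (hz : p ⊩ z ∈ₜ a) (hs : p ⊩ Sing s z) : p ⊩ s ∈ₜ w :=
  (h.allE s).iffE' (exI z (andI hz hs))

theorem Forces.usc_mem (h : p ⊩ Usc w a) (hs : p ⊩ Sing s z) (hsw : p ⊩ s ∈ₜ w) : p ⊩ z ∈ₜ a :=
  hs.bind fun hs => ((h.allE s).iffE hsw).exE fun _ hy =>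
    (hy.right.sing_eq hs.sing).symm.memL hy.left

theorem Forces.usc_incl (h : p ⊩ Usc w a) (hzw : p ⊩ Incl z w) :
    p ⊩ .ex fun d => Usc z d ∧ₜ Incl d a := by
  have hd : p ⊩ .ex fun d => .all fun x => x ∈ₜ d ↔ₜ (x ∈ₜ a ∧ₜ .ex fun t => t ∈ₜ z ∧ₜ Sing t x) :=
    comprehension (0 ∊ 1 ⋏ ex (0 ∊ 3 ⋏ isSingleton 0 1)) (push 0 (push 1 fun _ => 2))
      (push a (push z id)) (by simp) p
  refine h.bind fun h => hzw.bind fun hzw => hd.exE fun d hd => exI d (andI (allI fun s =>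
    iffI (fun hs => ?_) fun hs => ?_) (incl_intro fun x hx => ((hd.allE x).iffE hx).left))
  · exact ((h.allE s).iffE (hzw.incl hs)).exE fun x hx =>
      exI x (andI ((hd.allE x).iffE' (andI hx.left (exI s (andI hs hx.right)))) hx.right)
  · exact hs.exE fun x hx => ((hd.allE x).iffE hx.left).right.exE fun t ht =>
      (ht.right.sing_unique hx.right).memL ht.left

theorem Forces.usc_part (h : p ⊩ Usc w a) (hzw : p ⊩ Part z w) :
    p ⊩ .ex fun d => Usc z d ∧ₜ Part d a :=
  h.bind fun h => hzw.bind fun hzw => (h.usc_incl hzw.left).exE fun d hd => exI d <|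
    andI hd.left <| part_intro hd.right fun x hx => (exists_sing x _).exE fun _ ht =>
      hzw.part_cases (h.usc_intro hx ht) (fun htz => inl (hd.left.usc_mem ht htz)) fun htz =>
        inr (negI fun hxd => htz.absurd (hd.left.usc_intro hxd ht))

/-- Turns the successor step for the cardinal of `USC(b)` into the adjunction of a point to the
underlying set. -/
theorem Forces.usc_adj (h : p ⊩ Usc w b) (hw : p ⊩ Adj w z s) (hs : p ⊩ ¬ₜ (s ∈ₜ z))
    (hC : ∀ {q : World} [Le p q] (d c : ℕ), (∀ {r : World} [Le q r], r ⊩ Usc z d) →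
      (∀ {r : World} [Le q r], r ⊩ ¬ₜ (c ∈ₜ d)) → (∀ {r : World} [Le q r], r ⊩ Adj b d c) →
      (q ⊩ C)) : p ⊩ C := by
  refine h.bind fun h => hw.bind fun hw => hs.bind fun hs =>
    (h.usc_incl (incl_intro fun t ht => hw.adj_old ht)).exE fun d hd =>
    ((h.allE s).iffE hw.adj_new).exE fun c hc => hC d c hd.left
      (negI fun hcd => hs.absurd (hd.left.usc_intro hcd hc.right))
      (adj_intro hd.right hc.left fun x hx => (exists_sing x _).exE fun t ht => ?_)
  exact hw.adj_cases (h.usc_intro hx ht) (fun htz => inl (hd.left.usc_mem ht htz)) fun e =>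
    inr (hc.right.sing_eq (e.memR ht.sing))

/-- A separated subset of `b` decides whether it contains `c`. If not, it is a separated subset of
`d`; if so, it is its trace on `d` with `c` adjoined. -/
theorem ssc_union (hb : p ⊩ Adj b d c) (hc : p ⊩ ¬ₜ (c ∈ₜ d)) (hs : p ⊩ Ssc s b)
    (ht : p ⊩ Ssc t d) (hv : p ⊩ AdjImage v t c) : p ⊩ Union s t v := by
  refine hb.bind fun hb => hc.bind fun hc => hs.bind fun hs => ht.bind fun ht => hv.bind fun hv =>
    allI fun u => iffI (fun hu => ?_) fun hu => ?_
  · refine ((hs.allE u).iffE hu).bind fun hu => hu.part_cases hb.adj_new (fun hcu => inr ?_)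
      fun hcu => inl ((ht.allE u).iffE' (part_intro (incl_intro fun w hw => ?_) fun w hw => ?_))
    · have h : p ⊩ .ex fun u' => .all fun z => z ∈ₜ u' ↔ₜ (z ∈ₜ u ∧ₜ z ∈ₜ d) :=
        comprehension (0 ∊ 1 ⋏ 0 ∊ 2) (push 0 fun _ => 1) (push u (push d id)) (by simp) p
      refine h.persist.exE fun u' hu' => (hv.allE u).iffE' (exI u' (andI
        ((ht.allE u').iffE' (part_intro (incl_intro fun w hw => ((hu'.allE w).iffE hw).right)
          fun w hw => ?_)) (adj_intro (incl_intro fun w hw => ((hu'.allE w).iffE hw).left) hcu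
          fun w hw => ?_)))
      · exact hu.part_cases (hb.adj_old hw) (fun h => inl ((hu'.allE w).iffE' (andI h hw)))
          fun h => inr (negI fun h' => h.absurd ((hu'.allE w).iffE h').left)
      · exact hb.adj_cases (hu.part hw) (fun h => inl ((hu'.allE w).iffE' (andI hw h)))
          fun h => h.inr
    · exact hb.adj_cases (hu.part hw) (fun h => h) fun e => hcu.absurd (e.memL hw)
    · exact hu.part_cases (hb.adj_old hw) (fun h => h.inl) fun h => h.inr
  · refine (hs.allE u).iffE' (hu.cases (fun hu => ?_) fun hu => ?_)
    · refine ((ht.allE u).iffE hu).part_trans (part_intro (incl_intro fun w hw => hb.adj_old hw)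
        fun w hw => hb.adj_cases hw (fun h => h.inl) fun e => inr (negI fun h =>
          hc.absurd (e.memL h)))
    · exact ((hv.allE u).iffE hu).exE fun u' hu' =>
        ((ht.allE u').iffE hu'.left).part_adj hu'.right hb hc

theorem Forces.ssc_not_mem (ht : p ⊩ Ssc t d) (hc : p ⊩ ¬ₜ (c ∈ₜ d)) :
    p ⊩ .all fun u => u ∈ₜ t →ₜ ¬ₜ (c ∈ₜ u) :=
  ht.bind fun ht => hc.bind fun hc => allI fun u => impI fun hu => negI fun h =>
    hc.absurd (((ht.allE u).iffE hu).part h)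

theorem adjImage_disj (hc : p ⊩ .all fun u => u ∈ₜ t →ₜ ¬ₜ (c ∈ₜ u))
    (hv : p ⊩ AdjImage v t c) : p ⊩ Disj t v :=
  hc.bind fun hc => hv.bind fun hv => allI fun u => impI fun hu => negI fun hu' =>
    ((hv.allE u).iffE hu').exE fun _ h => ((hc.allE u).mp hu).absurd h.right.adj_new

/-- If `USC(b)` is finite, then so is `SSC(b)`, and its cardinal is determined by that of
`USC(b)`. -/
theorem exists_powBound (hm : p ⊩ FinCard m) (hb : p ⊩ Usc w b) (hw : p ⊩ w ∈ₜ m) :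
    p ⊩ .ex fun k => FinCard k ∧ₜ PowBound k m := by
  have key : p ⊩ .all fun b => .all fun w => Usc w b →ₜ w ∈ₜ m →ₜ
      .ex fun k => FinCard k ∧ₜ PowBound k m := by
    refine induction (P := fun m => .all fun b => .all fun w => Usc w b →ₜ w ∈ₜ m →ₜ
        .ex fun k => FinCard k ∧ₜ PowBound k m)
      (all (all (isUSC 0 1 ⇒ 0 ∊ 2 ⇒ ex (isFiniteCardinal 0 ⋏
        all (all (all (isUSC 1 2 ⇒ 1 ∊ 6 ⇒ isSSC 0 2 ⇒ 0 ∊ 3)))))))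
      -- `USC` and `SSC` both raise the type by one, so `k` and `m` can share the type 3.
      (fun _ => 3) id (by simp) (fun _ => rfl) ?_ ?_ hm
    · refine fun m hm => allI fun b => allI fun w => impI fun hb => impI fun hw =>
        (exists_zeroCard _).exE fun z hz => (exists_succCard z _).exE fun k hk => ?_
      have he : p ⊩ .ex fun e => .all fun x => x ∈ₜ e ↔ₜ .bot :=
        comprehension Fml.bot (fun _ => 0) id trivial p
      refine he.persist.exE fun e he => bind (A := PowBound k m) (allI fun d => allI fun w =>
        allI fun s => impI fun hd => impI fun hw => impI fun hs => ?_) fun h =>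
        exI k (andI (hk.succ_fin hz.zero_fin ?_) h)
      -- Here `d` is empty, so `SSC(d) = {Λ}`, which lies in the successor of zero.
      · refine bind (A := Void d) (allI fun x => negI fun h => (exists_sing x _).exE fun t ht =>
          (hm.zero hw).void (hd.usc_intro h ht)) fun hd => bind (A := Void e) (allI fun x =>
          negI fun h => (he.allE x).iffE h) fun he => hk.succ_intro ((hz.allE e).iffE' he)
          (he.allE e) (adj_intro (incl_intro fun x hx => he.void hx)
          ((hs.allE e).iffE' (part_void he)) fun u hu => inr (void_eq (allI fun x => negI fun hx =>
            hd.void (((hs.allE u).iffE hu).part hx)) he))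
      · exact (exists_ssc b _).exE fun s hs =>
          exI s ((((((h.allE b).allE w).allE s).mp hb).mp hw).mp hs)
    · refine fun m n hm hn ih => allI fun b => allI fun w => impI fun hb => impI fun hw =>
        hn.succ_elim hw fun w' s hw' hs hw => hb.usc_adj hw hs fun d c hd hc hbd =>
        ((((ih.allE d).allE w').mp hd).mp hw').exE fun k hk =>
        (exists_ssc d _).exE fun t ht => (exists_adjImage t c _).exE fun v hv => ?_
      -- The bound is `k + k`. The given `b` supplies the disjoint sets required by `exists_sum`;
      -- the bound is then checked for an arbitrary new `b`.
      refine ((((((hk.right.allE d).allE w').allE t).mp hd).mp hw').mp ht).bind fun htk =>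
        (ht.ssc_not_mem hc).bind fun hct => (exists_sum hk.left hk.left htk
          (adjImage_mem hk.left htk hct hv) (adjImage_disj hct hv)).exE fun l hl =>
        exI l (andI hl.left (allI fun b => allI fun w => allI fun s => impI fun hb =>
          impI fun hw => impI fun hs => hn.succ_elim hw fun w' a hw' ha hw =>
          hb.usc_adj hw ha fun d c hd hc hbd => (exists_ssc d _).exE fun t ht =>
          (exists_adjImage t c _).exE fun v hv => ?_))
      refine ((((((hk.right.allE d).allE w').allE t).mp hd).mp hw').mp ht).bind fun htk =>
        (ht.ssc_not_mem hc).bind fun hct => ?_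
      exact (((((((hl.right.allE t).allE v).allE s).mp htk).mp
        (adjImage_mem hk.left htk hct hv)).mp (adjImage_disj hct hv)).mp
        (ssc_union hbd hc hs ht hv))
  exact (((key.allE b).allE w).mp hb).mp hw

/-! ### Similarity -/

theorem Forces.sim (h : p ⊩ Sim x y) : p ⊩ .ex fun f => Biject f x y :=
  h.exE fun f h => exI f <| andI
    (allI fun a => impI fun ha => ((h.right.left.allE a).mp ha).exE fun b hb => exI b hb.left)
    (andI h.right.right.right (andI h.left h.right.right.left.right))

/-- Finite cardinals are closed under similarity. -/
theorem mem_of_sim (hk : p ⊩ FinCard k) (hx : p ⊩ x ∈ₜ k) (hux : p ⊩ Sim u x) : p ⊩ u ∈ₜ k := by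
  have key : p ⊩ .all fun x => .all fun u => .all fun f => x ∈ₜ k →ₜ Biject f u x →ₜ u ∈ₜ k := by
    refine induction
      (P := fun k => .all fun x => .all fun u => .all fun f => x ∈ₜ k →ₜ Biject f u x →ₜ u ∈ₜ k)
      (all (all (all (2 ∊ 3 ⇒
        ((all (0 ∊ 2 ⇒ ex (0 ∊ 4 ⋏ pairMem 1 0 2))) ⋏ (all (0 ∊ 3 ⇒ ex (0 ∊ 3 ⋏ pairMem 0 1 2))) ⋏
        isFunction 0 ⋏ all (all (all ((2 ∊ 4 ⋏ 1 ∊ 4 ⋏ pairMem 2 0 3 ⋏ pairMem 1 0 3) ⇒ 2 ≐ 1)))) ⇒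
        1 ∊ 3))))
      (fun _ => 2) id (by simp) (fun _ => rfl) ?_ ?_ hk
    · exact fun k hk => allI fun x => allI fun u => allI fun f => impI fun hx => impI fun h =>
        (hk.allE u).iffE' (allI fun a => negI fun ha => ((h.left.allE a).mp ha).exE fun b hb =>
          (hk.zero hx).void hb.left)
    · refine fun k s hk hs ih => allI fun x => allI fun u => allI fun f => impI fun hx =>
        impI fun h => hs.succ_elim hx fun z c hz hc hx =>
        ((h.right.left.allE c).mp hx.adj_new).exE fun d hd => ?_
      -- `v` consists of the members of `u` sent into `z`. It is `u` without the point `d` over `c`,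
      -- and the same `f` serves for it.
      have hv : p ⊩ .ex fun v => .all fun a => a ∈ₜ v ↔ₜ
          (a ∈ₜ u ∧ₜ .ex fun b => b ∈ₜ z ∧ₜ PairMem a b f) :=
        comprehension (0 ∊ 1 ⋏ ex (0 ∊ 3 ⋏ pairMem 1 0 4))
          (push 0 (push 1 (push 1 fun _ => 3))) (push u (push z (push f id))) (by simp) p
      refine hv.persist.exE fun v hv => hs.succ_intro (z := v) (a := d) ?_ (negI fun h' => ?_) ?_
      · refine (((ih.allE z).allE v).allE f).mp hz |>.mp (andI (allI fun a => impI fun ha => ?_)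
          (andI (allI fun b => impI fun hb => ?_) (andI h.right.right.left ?_)))
        · exact ((hv.allE a).iffE ha).right
        · exact ((h.right.left.allE b).mp (hx.adj_old hb)).exE fun a ha => exI a (andI
            ((hv.allE a).iffE' (andI ha.left (exI b (andI hb ha.right)))) ha.right)
        · exact allI fun a => allI fun a' => allI fun b => impI fun h' =>
            (((h.right.right.right.allE a).allE a').allE b).mp (andI ((hv.allE a).iffE h'.left).left
              (andI ((hv.allE a').iffE h'.right.left).left h'.right.right))
      · exact ((hv.allE d).iffE h').right.exE fun b hb => hc.absurd
          (((((h.right.right.left.allE d).allE b).allE c).mp (andI hb.right hd.right)).memL hb.left)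
      · refine adj_intro (incl_intro fun a ha => ((hv.allE a).iffE ha).left) hd.left fun a ha =>
          ((h.left.allE a).mp ha).exE fun b hb => hx.adj_cases hb.left
            (fun hbz => inl ((hv.allE a).iffE' (andI ha (exI b (andI hbz hb.right))))) fun e =>
            inr ((((h.right.right.right.allE a).allE d).allE c).mp (andI ha (andI hd.left
              (andI (eq_subst (pairMem 1 0 2) (push a (push f id)) e hb.right) hd.right))))
  exact hux.sim.exE fun f hf => ((((key.persist.allE x).allE u).allE f).mp hx.persist).mp hf

/-- The only function constructed is an identity, so diagonal pairs suffice. The set `{x, y}` is one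
of `{z}` and `{z, z}`, so its members all equal `z`. -/
theorem opair_diag (h : p ⊩ OPair s x y) (h' : p ⊩ OPair s z z) : p ⊩ x =ₜ z ∧ₜ y =ₜ z := by
  have ht : p ⊩ .ex fun t => UPair t x y :=
    comprehension (0 ≐ 1 ⋎ 0 ≐ 2) (fun _ => 0) (push x (push y id)) (by simp) p
  refine h.bind fun h => h'.bind fun h' => ht.exE fun t ht => bind (A := .all fun w =>
    w ∈ₜ t →ₜ w =ₜ z) ?_ fun hw => andI ((hw.allE x).mp ((ht.allE x).iffE' (eq_refl x).inl))
      ((hw.allE y).mp ((ht.allE y).iffE' (eq_refl y).inr))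
  exact ((h'.allE t).iffE ((h.allE t).iffE' ht.inr)).cases
    (fun h => allI fun w => impI fun hw => h.sing_eq hw)
    fun h => allI fun w => impI fun hw => ((h.allE w).iffE hw).cases (fun e => e) fun e => e

/-- Needed to put `SSC(a)` itself into `2^m`. -/
theorem sim_refl (x : ℕ) (p : World) : p ⊩ Sim x x := by
  have hf : p ⊩ .ex fun f => .all fun s => s ∈ₜ f ↔ₜ .ex fun a => a ∈ₜ x ∧ₜ OPair s a a :=
    comprehension (ex (0 ∊ 2 ⋏ isOrderedPair 1 0 0)) (push 2 fun _ => 1) (push x id) (by simp) p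
  refine hf.exE fun f hf => bind (A := .all fun a => .all fun b => PairMem a b f →ₜ
    (a =ₜ b ∧ₜ a ∈ₜ x)) ?_ fun h => bind (A := .all fun a => a ∈ₜ x →ₜ PairMem a a f) ?_
    fun h' => ?_
  · exact allI fun a => allI fun b => impI fun h => h.exE fun s hs =>
      ((hf.allE s).iffE hs.right).exE fun c hc => (opair_diag hs.left hc.right).bind fun e =>
        andI (e.left.trans e.right.symm) (e.left.symm.memL hc.left)
  · refine allI fun a => impI fun ha => ?_
    have hs : p ⊩ .ex fun s => OPair s a a :=
      comprehension (isSingleton 0 1 ⋎ isPair 0 1 2) (push 1 fun _ => 0) (push a (push a id))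
        (by simp) p
    exact hs.persist.exE fun s hs => exI s (andI hs ((hf.allE s).iffE' (exI a (andI ha hs))))
  · refine exI f (andI ?_ (andI ?_ (andI (andI ?_ ?_) ?_)))
    · exact allI fun a => allI fun b => allI fun c => impI fun hab =>
        (((h.allE a).allE b).mp hab.left).left.symm.trans (((h.allE a).allE c).mp hab.right).left
    · exact allI fun a => impI fun ha => exI a (andI (andI ha ((h'.allE a).mp ha))
        (allI fun b => impI fun hb => (((h.allE a).allE b).mp hb.right).left.symm))
    · exact allI fun a => allI fun b => impI fun hb => (((h.allE a).allE b).mp hb.right).right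
    · exact allI fun a => allI fun b => allI fun c => impI fun hc =>
        (((h.allE a).allE c).mp hc.right.right.left).left.trans
          (((h.allE b).allE c).mp hc.right.right.right).left.symm
    · exact allI fun a => impI fun ha => exI a (andI ha ((h'.allE a).mp ha))

end

/-! ### Exponentiation -/

section

variable {p : World} {C : Truth} {a b d e e' k l m n s t u w w' x : ℕ}

theorem exists_twoPow (m : ℕ) (p : World) : p ⊩ .ex fun e => TwoPow e m :=
  comprehension (ex (ex (isUSC 0 1 ⋏ 0 ∊ 3) ⋏ ex (isSSC 0 1 ⋏ similar 2 0)))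
    (push 2 fun _ => 3) (push m id)
    -- With `a` of type 1, `USC(a)` and `SSC(a)` have type 2, so `m` and `2^m` both get type 3.
    ⟨1, by simp⟩ p

theorem Forces.twoPow_intro (h : p ⊩ TwoPow e m) (hw : p ⊩ Usc w a) (hwm : p ⊩ w ∈ₜ m)
    (hs : p ⊩ Ssc s a) : p ⊩ s ∈ₜ e :=
  (h.allE s).iffE' (exI a (andI (exI w (andI hw hwm)) (exI s (andI hs (sim_refl s p)))))

theorem Forces.twoPow_elim (h : p ⊩ TwoPow e m) (hu : p ⊩ u ∈ₜ e)
    (hC : ∀ {q : World} [Le p q] (a w s : ℕ), (∀ {r : World} [Le q r], r ⊩ Usc w a) →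
      (∀ {r : World} [Le q r], r ⊩ w ∈ₜ m) → (∀ {r : World} [Le q r], r ⊩ Ssc s a) →
      (∀ {r : World} [Le q r], r ⊩ Sim u s) → (q ⊩ C)) : p ⊩ C :=
  ((h.allE u).iffE hu).exE fun a h => h.left.exE fun w hw => h.right.exE fun s hs =>
    hC a w s hw.left hw.right hs.left hs.right

theorem ssc_incl (hda : p ⊩ Part d a) (hs : p ⊩ Ssc s d) (ht : p ⊩ Ssc t a) : p ⊩ Incl s t :=
  hda.bind fun hda => hs.bind fun hs => ht.bind fun ht => incl_intro fun u hu =>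
    (ht.allE u).iffE' (((hs.allE u).iffE hu).part_trans hda)

/-- A part of `USC(a)` is all of it if it is the set of singletons of a set with as many separated
subsets as `a`. -/
theorem eq_of_part (hn : p ⊩ FinCard n) (hm : p ⊩ FinCard m) (hk : p ⊩ FinCard k)
    (hw : p ⊩ Usc w a) (hwn : p ⊩ w ∈ₜ n) (hs : p ⊩ Ssc s a) (hsk : p ⊩ s ∈ₜ k)
    (hkm : p ⊩ PowBound k m) (hx : p ⊩ x ∈ₜ m) (hxw : p ⊩ Part x w) : p ⊩ n =ₜ m := by
  refine hn.bind fun hn => hm.bind fun hm => hk.bind fun hk => hw.bind fun hw => hwn.bind fun hwn =>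
    hs.bind fun hs => hsk.bind fun hsk => hkm.bind fun hkm => hx.bind fun hx => hxw.bind fun hxw =>
    (hw.usc_part hxw).exE fun d hd => (exists_ssc d _).exE fun t ht => ?_
  -- `SSC(d) ⊆ SSC(a)` have the same finite cardinal `k`, so `a`, a member of the second, belongs to
  -- the first.
  refine (incl_of_incl hk hsk ((((((hkm.allE d).allE x).allE t).mp hd.left).mp hx).mp ht)
    (ssc_incl hd.right ht hs)).bind fun hst =>
    (((ht.allE a).iffE (hst.incl ((hs.allE a).iffE' (part_refl a))))).bind fun had => ?_
  refine finCard_unique hn hm hwn (memL (extensionality (x := x) (fun y hy => hxw.part hy)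
    fun y hy => ((hw.allE y).iffE hy).exE fun z hz => ?_) hx)
  exact hd.left.usc_intro (had.part hz.left) hz.right

theorem twoPow_injective (hn : p ⊩ FinCard n) (hm : p ⊩ FinCard m) (he : p ⊩ TwoPow e n)
    (he' : p ⊩ TwoPow e' m) (hee' : p ⊩ e =ₜ e') (hi : p ⊩ Inh e) : p ⊩ n =ₜ m := by
  refine hn.bind fun hn => hm.bind fun hm => he.bind fun he => he'.bind fun he' =>
    hee'.bind fun hee' => hi.exE fun u hu => he.twoPow_elim hu fun a w s hw hwn hs hus =>
    he'.twoPow_elim (hee'.memR hu) fun b w' t hw' hwm ht hut =>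
    (exists_powBound hn hw hwn).exE fun k hk => (exists_powBound hm hw' hwm).exE fun l hl => ?_
  refine ((((((hk.right.allE a).allE w).allE s).mp hw).mp hwn).mp hs).bind fun hsk =>
    ((((((hl.right.allE b).allE w').allE t).mp hw').mp hwm).mp ht).bind fun htl =>
    -- `u` lies in both `k` and `l`, which are therefore equal.
    (finCard_unique hk.left hl.left (mem_of_sim hk.left hsk hus)
      (mem_of_sim hl.left htl hut)).bind fun hkl => (part_total hn hm hwn hwm).cases
      (fun h => h.exE fun x hx => ?_) fun h => h.exE fun x hx => ?_
  · exact eq_of_part hn hm hl.left hw hwn hs (hkl.memR hsk) hl.right hx.left hx.right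
  · exact (eq_of_part hm hn hk.left hw' hwm ht (hkl.symm.memR htl) hk.right hx.left hx.right).symm

/-- Inclusion of separated subsets of a set `a` with `USC(a)` finite is decidable. -/
theorem part_incl_decidable (hn : p ⊩ FinCard n) (hw : p ⊩ Usc w a) (hwn : p ⊩ w ∈ₜ n)
    (hu : p ⊩ Part u a) (hd : p ⊩ Part d a) : p ⊩ Incl u d ∨ₜ ¬ₜ (Incl u d) := by
  -- Finiteness is given for `USC(a)`, so the inclusion is expressed by singletons: `w ⊆ y` amounts
  -- to `u ⊆ d`.
  have hy : p ⊩ .ex fun y => .all fun s => s ∈ₜ y ↔ₜ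
      .ex fun x => Sing s x ∧ₜ (x ∈ₜ u →ₜ x ∈ₜ d) :=
    comprehension (ex (isSingleton 1 0 ⋏ (0 ∊ 2 ⇒ 0 ∊ 3))) (fun _ => 1) (push u (push d id))
      (by simp) p
  refine hn.bind fun hn => hw.bind fun hw => hwn.bind fun hwn => hu.bind fun hu =>
    hd.bind fun hd => hy.exE fun y hy =>
    (incl_decidable hn hwn (y := y) (allI fun s => impI fun hs =>
      ((hw.allE s).iffE hs).exE fun x hx => ?_)).cases (fun h => inl (incl_intro fun x hx => ?_))
      fun h => inr (negI fun h' => h.absurd (incl_intro fun s hs => ?_))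
  · refine hu.part_cases hx.left (fun hxu => hd.part_cases hx.left (fun hxd => ?_)
      fun hxd => inr (negI fun h => ?_)) fun hxu => ?_
    · exact inl ((hy.allE s).iffE' (exI x (andI hx.right (impI fun _ => hxd))))
    · exact ((hy.allE s).iffE h).exE fun z hz =>
        (hx.right.sing_eq hz.left.sing).bind fun hzx =>
          hxd.absurd (hzx.memL (hz.right.mp (hzx.symm.memL hxu)))
    · exact inl ((hy.allE s).iffE' (exI x (andI hx.right (impI fun h => hxu.absurd h))))
  · refine (exists_sing x _).exE fun s hs =>
      ((hy.allE s).iffE (h.incl (hw.usc_intro (hu.part hx) hs))).exE fun z hz => ?_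
    exact (hs.sing_eq hz.left.sing).bind fun hzx =>
      hzx.memL (hz.right.mp (hzx.symm.memL hx))
  · exact ((hw.allE s).iffE hs).exE fun x hx =>
      (hy.allE s).iffE' (exI x (andI hx.right (impI fun hxu => h'.incl hxu)))

theorem twoPow_strictMono (hm : p ⊩ FinCard m) (hn : p ⊩ FinCard n) (he : p ⊩ TwoPow e m)
    (he' : p ⊩ TwoPow e' n) (hmn : p ⊩ CardLt m n) (hi : p ⊩ Inh e') :
    p ⊩ Inh e ∧ₜ CardLt e e' := by
  refine hn.bind fun hn => hm.bind fun hm => he.bind fun he => he'.bind fun he' =>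
    hmn.bind fun hmn => hi.exE fun u hu => he'.twoPow_elim hu fun c w _ hw hwn _ _ =>
    hmn.left.exE fun a h => h.exE fun b h => (exists_part hn hm h.left h.right.left h.right.right
      hwn).exE fun v hv => (hw.usc_part hv.right).exE fun d hd =>
    (exists_ssc d _).exE fun s hs => (exists_ssc c _).exE fun t ht => ?_
  refine (he.twoPow_intro hd.left hv.left hs).bind fun hse =>
    (he'.twoPow_intro hw hwn ht).bind fun hte => bind (A := Inh e) (exI s hse) fun hie => ?_
  -- `SSC(d)` and `SSC(c)` witness the inequality; the values differ by injectivity, since `2^m` is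
  -- inhabited.
  refine andI hie (andI (exI s (exI t (andI hse (andI hte (part_intro (ssc_incl hd.right hs ht)
    fun x hx => ?_))))) (negI fun h => hmn.right.absurd (twoPow_injective hm hn he he' h hie)))
  refine ((ht.allE x).iffE hx).bind fun hxc => (part_incl_decidable hn hw hwn hxc hd.right).cases
    (fun h => inl ((hs.allE x).iffE' (part_intro h fun z hz => ?_)))
    fun h => inr (negI fun h' => h.absurd ((hs.allE x).iffE h').left)
  exact hxc.part_cases (hd.right.part hz) (fun h => h.inl) fun h => h.inr

end

/-! ### Return to the formal sentences -/

theorem provable_twoPowInjective : Provable twoPowInjective := by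
  refine Fml.provable_of_forces fun p => ?_
  change p ⊩ .all fun n => .all fun m => (FinCard n ∧ₜ FinCard m) →ₜ .ex fun e => .ex fun e' =>
    TwoPow e n ∧ₜ TwoPow e' m ∧ₜ ((e =ₜ e' ∧ₜ Inh e) →ₜ n =ₜ m)
  exact allI fun n => allI fun m => impI fun h => (exists_twoPow n _).exE fun e he =>
    (exists_twoPow m _).exE fun e' he' => exI e (exI e' (andI he (andI he' (impI fun h' =>
      twoPow_injective h.left h.right he he' h'.left h'.right))))

theorem provable_twoPowStrictMono : Provable twoPowStrictMono := by
  refine Fml.provable_of_forces fun p => ?_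
  change p ⊩ .all fun m => .all fun n => (FinCard m ∧ₜ FinCard n) →ₜ .ex fun e => .ex fun e' =>
    TwoPow e m ∧ₜ TwoPow e' n ∧ₜ ((CardLt m n ∧ₜ Inh e') →ₜ (Inh e ∧ₜ CardLt e e'))
  exact allI fun m => allI fun n => impI fun h => (exists_twoPow m _).exE fun e he =>
    (exists_twoPow n _).exE fun e' he' => exI e (exI e' (andI he (andI he' (impI fun h' =>
      twoPow_strictMono h.left h.right he he' h'.left h'.right))))

end INF

theorem mainTheorem5 :
    INF.Provable INF.twoPowInjective ∧ INF.Provable INF.twoPowStrictMono :=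
  ⟨INF.provable_twoPowInjective, INF.provable_twoPowStrictMono⟩
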